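/- Let $n\ge 2$. Let $\mathfrak{psl}_{n|n}$ be the quotient of the complex Lie superalgebra of supermatrices $X\in\mathrm{End}(\mathbb{C}^{n|n})$ with $\mathrm{str}\,X=0$ by the multiples of the identity, with the invariant form $\mathrm{str}(XY)$, and let $V^1(\mathfrak{psl}_{n|n})$ be its universal affine vertex superalgebra at level $1$ with vacuum $|0\rangle$. Write $E^{i,j}$ for the elementary supermatrices ($1\le i,j\le 2n$; the indices $1,\dots,n$ are even and $n+1,\dots,2n$ are odd), $x_{(m)}$ for the modes of $x\in\mathfrak{psl}_{n|n}$, and let $U$ be the submodule of $V^1(\mathfrak{psl}_{n|n})$ generated by $$\chi=E^{1,2n-1}_{(-1)}E^{1,2n}_{(-1)}|0\rangle .$$ For a quotient $V$ of $V^1(\mathfrak{psl}_{n|n})$ by a submodule put $C_2(V)=\mathrm{span}\{x_{(-m)}v : x\in\mathfrak{psl}_{n|n},\ m\ge 2,\ v\in V\}$, let $R_V=V/C_2(V)$ be the Zhu $C_2$-algebra with product $\overline a\cdot\overline b=\overline{a_{(-1)}b}$, and let $X_V=\mathrm{specm}\,R_V$ be the associated variety; it is regarded as a subset of $\mathfrak{psl}_{n|n}^*$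 by sending the point given by a character $\varphi:R_V\to\mathbb{C}$ to the functional $x\mapsto\varphi(\overline{x_{(-1)}|0\rangle})$ (which vanishes on odd $x$). Embed $\mathfrak{sl}_n$ in $\mathfrak{psl}_{n|n}^*$ by sending $Z$ to $X\mapsto\frac{1}{2n}\mathrm{tr}(X_{22}Z)$, where $X_{22}$ is the lower right $n\times n$ block of $X$, and let $\overline{\mathbb{O}_{\min}(\mathfrak{sl}_n)}$ be the closure of the minimal nilpotent orbit $\mathbb{O}_{\min}(\mathfrak{sl}_n)=\{Z\in\mathfrak{sl}_n : \mathrm{rank}\,Z=1\}$. Then $$X_{V^1(\mathfrak{psl}_{n|n})/U}\subseteq\overline{\mathbb{O}_{\min}(\mathfrak{sl}_n)} .$$ -/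

import Mathlib

noncomputable section

namespace Affine

/-- The Koszul sign `(-1)^(a b)`. -/
def koszul (a b : ZMod 2) : ℂ := if a = 1 ∧ b = 1 then -1 else 1

/-- A complex Lie superalgebra with an even invariant supersymmetric bilinear form. -/
structure LieSuperalgebra (g : Type) [AddCommGroup g] [Module ℂ g] where
  /-- the parity automorphism: `+1` on the even part and `-1` on the odd part -/
  par : g →ₗ[ℂ] g
  par_par : ∀ x, par (par x) = x
  bracket : g →ₗ[ℂ] g →ₗ[ℂ] g
  form : g →ₗ[ℂ] g →ₗ[ℂ] ℂ
  par_bracket : ∀ x y, par (bracket x y) = bracket (par x) (par y)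
  form_par : ∀ x y, form (par x) (par y) = form x y
  bracket_skew : ∀ (a b : ZMod 2) (x y : g), par x = koszul a 1 • x → par y = koszul b 1 • y →
    bracket x y = -(koszul a b • bracket y x)
  jacobi : ∀ (a b : ZMod 2) (x y z : g), par x = koszul a 1 • x → par y = koszul b 1 • y →
    bracket x (bracket y z) = bracket (bracket x y) z + koszul a b • bracket y (bracket x z)
  form_symm : ∀ (a b : ZMod 2) (x y : g), par x = koszul a 1 • x → par y = koszul b 1 • y →
    form x y = koszul a b • form y x
  form_invariant : ∀ (a b : ZMod 2) (x y z : g), par x = koszul a 1 • x →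
    par y = koszul b 1 • y →
    form (bracket x y) z = form x (bracket y z)

variable {g : Type} [AddCommGroup g] [Module ℂ g]

namespace LieSuperalgebra

/-- The homogeneous component of parity `a`. -/
def gr (S : LieSuperalgebra g) (a : ZMod 2) : Submodule ℂ g where
  carrier := {x | S.par x = koszul a 1 • x}
  add_mem' := by
    intro x y hx hy
    simp only [Set.mem_ofPred_eq] at *
    rw [map_add, hx, hy, smul_add]
  zero_mem' := by simp
  smul_mem' := by
    intro c x hx
    simp only [Set.mem_ofPred_eq] at *
    rw [map_smul, hx, smul_comm]

/-- The projection to the even part. -/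
def even (S : LieSuperalgebra g) : g →ₗ[ℂ] g := (2⁻¹ : ℂ) • (LinearMap.id + S.par)

/-- The projection to the odd part. -/
def odd (S : LieSuperalgebra g) : g →ₗ[ℂ] g := (2⁻¹ : ℂ) • (LinearMap.id - S.par)

variable (S : LieSuperalgebra g) (k : ℂ)

/-- The defining relations of the enveloping algebra of the affinization of `g` with the central
element `K` set to `k`; the generator `(x, m)` stands for `x ⊗ t ^ m`. -/
inductive AffRel : FreeAlgebra ℂ (g × ℤ) → FreeAlgebra ℂ (g × ℤ) → Prop
  | add (x y : g) (m : ℤ) :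
      AffRel (FreeAlgebra.ι ℂ (x + y, m)) (FreeAlgebra.ι ℂ (x, m) + FreeAlgebra.ι ℂ (y, m))
  | smul (c : ℂ) (x : g) (m : ℤ) :
      AffRel (FreeAlgebra.ι ℂ (c • x, m)) (c • FreeAlgebra.ι ℂ (x, m))
  | comm (a b : ZMod 2) (x y : g) (hx : x ∈ S.gr a) (hy : y ∈ S.gr b) (m n : ℤ) :
      AffRel (FreeAlgebra.ι ℂ (x, m) * FreeAlgebra.ι ℂ (y, n))
        (koszul a b • (FreeAlgebra.ι ℂ (y, n) * FreeAlgebra.ι ℂ (x, m))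
          + FreeAlgebra.ι ℂ (S.bracket x y, m + n)
          + algebraMap ℂ _ (if m + n = 0 then k * m * S.form x y else 0))

/-- The enveloping algebra of the affinization of `g` at level `k`. -/
abbrev Env : Type := RingQuot (S.AffRel k)

/-- The mode `x ⊗ t ^ m` in the enveloping algebra. -/
def gen (x : g) (m : ℤ) : S.Env k := RingQuot.mkAlgHom ℂ (S.AffRel k) (FreeAlgebra.ι ℂ (x, m))

/-- The left ideal generated by the modes `x ⊗ t ^ m` with `0 ≤ m`. -/
def vacIdeal : Submodule (S.Env k) (S.Env k) :=
  Submodule.span (S.Env k) {u | ∃ (x : g) (m : ℤ), 0 ≤ m ∧ u = S.gen k x m}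

/-- The universal affine vertex algebra `V^k(g)`: the module over the affinization induced from
the one-dimensional module of `g[t] ⊕ ℂ K` on which `g[t]` acts by zero and `K` by `k`. -/
def Vac : Type := S.Env k ⧸ S.vacIdeal k

instance : AddCommGroup (S.Vac k) := inferInstanceAs (AddCommGroup (S.Env k ⧸ S.vacIdeal k))

instance : Module (S.Env k) (S.Vac k) :=
  inferInstanceAs (Module (S.Env k) (S.Env k ⧸ S.vacIdeal k))

instance : Module ℂ (S.Vac k) := inferInstanceAs (Module ℂ (S.Env k ⧸ S.vacIdeal k))

instance : IsScalarTower ℂ (S.Env k) (S.Vac k) :=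
  inferInstanceAs (IsScalarTower ℂ (S.Env k) (S.Env k ⧸ S.vacIdeal k))

/-- The class of `u` in the induced module. -/
def toVac (u : S.Env k) : S.Vac k := Submodule.Quotient.mk u

/-- The vacuum vector. -/
def vac : S.Vac k := S.toVac k 1

/-- The action of the mode `x_(m) = x ⊗ t ^ m` on `V^k(g)`. -/
def mode (x : g) (m : ℤ) : Module.End ℂ (S.Vac k) :=
  Algebra.lsmul ℂ ℂ (S.Vac k) (S.gen k x m)

variable {S k}

lemma gen_add (x y : g) (m : ℤ) : S.gen k (x + y) m = S.gen k x m + S.gen k y m := by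
  simpa [gen] using RingQuot.mkAlgHom_rel ℂ (AffRel.add (S := S) (k := k) x y m)

lemma gen_smul (c : ℂ) (x : g) (m : ℤ) : S.gen k (c • x) m = c • S.gen k x m := by
  simpa [gen] using RingQuot.mkAlgHom_rel ℂ (AffRel.smul (S := S) (k := k) c x m)

lemma gen_comm {a b : ZMod 2} {x y : g} (hx : x ∈ S.gr a) (hy : y ∈ S.gr b) (m n : ℤ) :
    S.gen k x m * S.gen k y n = koszul a b • (S.gen k y n * S.gen k x m)
      + S.gen k (S.bracket x y) (m + n)
      + algebraMap ℂ _ (if m + n = 0 then k * m * S.form x y else 0) := by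
  have := RingQuot.mkAlgHom_rel ℂ (AffRel.comm (S := S) (k := k) a b x y hx hy m n)
  simp only [map_add, map_mul, map_smul, AlgHom.commutes] at this
  exact this

/-- Algebra maps out of the enveloping algebra. -/
def envLift {A : Type} [Ring A] [Algebra ℂ A] (f : g → ℤ → A)
    (hadd : ∀ x y m, f (x + y) m = f x m + f y m)
    (hsmul : ∀ (c : ℂ) x m, f (c • x) m = c • f x m)
    (hcomm : ∀ (a b : ZMod 2) (x y : g), x ∈ S.gr a → y ∈ S.gr b → ∀ m n : ℤ,
      f x m * f y n = koszul a b • (f y n * f x m) + f (S.bracket x y) (m + n)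
        + algebraMap ℂ A (if m + n = 0 then k * m * S.form x y else 0)) :
    S.Env k →ₐ[ℂ] A :=
  RingQuot.liftAlgHom ℂ ⟨FreeAlgebra.lift ℂ (fun p => f p.1 p.2), by
    intro u v h
    induction h with
    | add x y m => simp [hadd]
    | smul c x m => simp [hsmul]
    | comm a b x y hx hy m n =>
      simp only [map_add, map_mul, map_smul, AlgHom.commutes, FreeAlgebra.lift_ι_apply]
      exact hcomm a b x y hx hy m n⟩

lemma envLift_gen {A : Type} [Ring A] [Algebra ℂ A] (f : g → ℤ → A) (h1 h2 h3) (x : g) (m : ℤ) :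
    envLift (S := S) (k := k) f h1 h2 h3 (S.gen k x m) = f x m := by
  simp [envLift, gen]

/-- The universal property of the induced module. -/
def vacLift {M : Type} [AddCommGroup M] [Module ℂ M] (ρ : S.Env k →ₐ[ℂ] Module.End ℂ M) (w : M)
    (hw : ∀ (x : g) (m : ℤ), 0 ≤ m → ρ (S.gen k x m) w = 0) : S.Vac k →ₗ[ℂ] M :=
  (((S.vacIdeal k).restrictScalars ℂ).liftQ (ρ.toLinearMap.flip w) (by
      intro u hu
      rw [LinearMap.mem_ker, LinearMap.flip_apply, AlgHom.toLinearMap_apply]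
      have hu' : u ∈ S.vacIdeal k := hu
      unfold vacIdeal at hu'
      clear hu
      induction hu' using Submodule.span_induction with
      | mem u h => obtain ⟨x, m, hm, rfl⟩ := h; exact hw x m hm
      | zero => simp
      | add u v hu hv h1 h2 => rw [map_add, LinearMap.add_apply, h1, h2, add_zero]
      | smul c u hu h => rw [smul_eq_mul, map_mul, Module.End.mul_apply, h, map_zero])) ∘ₗ
    (Submodule.Quotient.restrictScalarsEquiv ℂ (S.vacIdeal k)).symm.toLinearMap

lemma vacLift_mk {M : Type} [AddCommGroup M] [Module ℂ M] (ρ : S.Env k →ₐ[ℂ] Module.End ℂ M)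
    (w : M) (hw) (u : S.Env k) : vacLift ρ w hw (S.toVac k u) = ρ u w := rfl

lemma vacLift_vac {M : Type} [AddCommGroup M] [Module ℂ M] (ρ : S.Env k →ₐ[ℂ] Module.End ℂ M)
    (w : M) (hw) : vacLift ρ w hw (S.vac k) = w := by
  rw [vac, vacLift_mk, map_one]; rfl

lemma vacLift_mode {M : Type} [AddCommGroup M] [Module ℂ M] (ρ : S.Env k →ₐ[ℂ] Module.End ℂ M)
    (w : M) (hw) (x : g) (m : ℤ) (v : S.Vac k) :
    vacLift ρ w hw (S.mode k x m v) = ρ (S.gen k x m) (vacLift ρ w hw v) := by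
  induction v using Submodule.Quotient.induction_on with
  | _ u =>
    change vacLift ρ w hw (S.toVac k (S.gen k x m * u)) = ρ _ (vacLift ρ w hw (S.toVac k u))
    rw [vacLift_mk, vacLift_mk, map_mul]; rfl

lemma mode_add (x y : g) (m : ℤ) : S.mode k (x + y) m = S.mode k x m + S.mode k y m := by
  simp [mode, gen_add]

lemma mode_smul (c : ℂ) (x : g) (m : ℤ) : S.mode k (c • x) m = c • S.mode k x m := by
  simp [mode, gen_smul]

lemma mode_comm {a b : ZMod 2} {x y : g} (hx : x ∈ S.gr a) (hy : y ∈ S.gr b) (m n : ℤ)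
    (v : S.Vac k) :
    S.mode k x m (S.mode k y n v) = koszul a b • S.mode k y n (S.mode k x m v)
      + S.mode k (S.bracket x y) (m + n) v
      + (if m + n = 0 then k * m * S.form x y else 0) • v := by
  have := congrArg (fun u : S.Env k => Algebra.lsmul ℂ ℂ (S.Vac k) u v)
    (gen_comm (k := k) hx hy m n)
  simp only [map_mul, map_add, map_smul, Module.End.mul_apply, LinearMap.add_apply,
    LinearMap.smul_apply, AlgHom.commutes, Module.algebraMap_end_apply] at this
  exact this

lemma mode_vac (x : g) (m : ℤ) (hm : 0 ≤ m) : S.mode k x m (S.vac k) = 0 := by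
  change S.toVac k (S.gen k x m * 1) = _
  rw [mul_one]
  refine (Submodule.Quotient.mk_eq_zero _).2 ?_
  exact Submodule.subset_span ⟨x, m, hm, rfl⟩

lemma vac_induction (W : Submodule ℂ (S.Vac k)) (h0 : S.vac k ∈ W)
    (h : ∀ x m v, v ∈ W → S.mode k x m v ∈ W) (v : S.Vac k) : v ∈ W := by
  have key : ∀ u : FreeAlgebra ℂ (g × ℤ), ∀ v ∈ W,
      Algebra.lsmul ℂ ℂ (S.Vac k) (RingQuot.mkAlgHom ℂ (S.AffRel k) u) v ∈ W := by
    intro u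
    induction u using FreeAlgebra.induction with
    | grade0 c =>
      intro v hv
      rw [AlgHom.commutes, AlgHom.commutes, Module.algebraMap_end_apply]
      exact W.smul_mem c hv
    | grade1 p => intro v hv; exact h p.1 p.2 v hv
    | mul a b ha hb =>
      intro v hv
      rw [map_mul, map_mul]
      exact ha _ (hb _ hv)
    | add a b ha hb =>
      intro v hv
      rw [map_add, map_add]
      exact W.add_mem (ha _ hv) (hb _ hv)
  induction v using Submodule.Quotient.induction_on with
  | _ u =>
    obtain ⟨u, rfl⟩ := RingQuot.mkAlgHom_surjective ℂ (S.AffRel k) u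
    have := key u _ h0
    change S.toVac k (_ * 1) ∈ W at this
    rwa [mul_one] at this

lemma even_mem (x : g) : S.even x ∈ S.gr 0 := by
  change S.par _ = koszul 0 1 • _
  simp [even, koszul, S.par_par, add_comm]

lemma odd_mem (x : g) : S.odd x ∈ S.gr 1 := by
  change S.par _ = koszul 1 1 • _
  simp [odd, koszul, S.par_par, ← smul_neg]

lemma even_add_odd (x : g) : S.even x + S.odd x = x := by
  simp only [even, odd, LinearMap.smul_apply, LinearMap.add_apply, LinearMap.sub_apply,
    LinearMap.id_apply, ← smul_add]
  rw [show x + S.par x + (x - S.par x) = (2 : ℂ) • x by rw [two_smul]; abel, smul_smul]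
  norm_num

lemma mode_eventually (v : S.Vac k) :
    ∀ᶠ N : ℤ in Filter.atTop, ∀ (x : g) (m : ℤ), N ≤ m → S.mode k x m v = 0 := by
  let W : Submodule ℂ (S.Vac k) :=
    { carrier := {v | ∀ᶠ N : ℤ in Filter.atTop, ∀ (x : g) (m : ℤ), N ≤ m → S.mode k x m v = 0}
      add_mem' := by
        intro v w hv hw
        filter_upwards [hv, hw] with N h1 h2 x m hm
        rw [map_add, h1 x m hm, h2 x m hm, add_zero]
      zero_mem' := by simp
      smul_mem' := by
        intro c v hv
        filter_upwards [hv] with N h1 x m hm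
        rw [map_smul, h1 x m hm, smul_zero] }
  refine vac_induction W ?_ ?_ v
  · filter_upwards [Filter.eventually_ge_atTop 0] with N hN x m hm
    exact mode_vac x m (hN.trans hm)
  · intro y n v hv
    obtain ⟨N0, hN0⟩ := Filter.eventually_atTop.1 (show ∀ᶠ N : ℤ in Filter.atTop, _ from hv)
    have key : ∀ (a b : ZMod 2) (x y : g), x ∈ S.gr a → y ∈ S.gr b → ∀ m : ℤ,
        N0 ≤ m → N0 ≤ m + n → 1 ≤ m + n → S.mode k x m (S.mode k y n v) = 0 := by
      intro a b x y hx hy m h1 h2 h3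
      rw [mode_comm hx hy, hN0 N0 le_rfl x m h1, hN0 N0 le_rfl _ (m + n) h2, if_neg (by omega)]
      simp
    filter_upwards [Filter.eventually_ge_atTop (max N0 (max (N0 - n) (1 - n)))] with N hN x m hm
    have h1 : N0 ≤ m := by omega
    have h2 : N0 ≤ m + n := by omega
    have h3 : 1 ≤ m + n := by omega
    rw [← even_add_odd (S := S) x, ← even_add_odd (S := S) y]
    simp only [mode_add, LinearMap.add_apply, map_add]
    rw [key _ _ _ _ (even_mem x) (even_mem y) m h1 h2 h3,
      key _ _ _ _ (odd_mem x) (even_mem y) m h1 h2 h3,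
      key _ _ _ _ (even_mem x) (odd_mem y) m h1 h2 h3,
      key _ _ _ _ (odd_mem x) (odd_mem y) m h1 h2 h3]
    simp

variable (S k)

/-- The parity automorphism of `V^k(g)`. -/
def parVac : S.Vac k →ₗ[ℂ] S.Vac k :=
  vacLift ((Algebra.lsmul ℂ ℂ (S.Vac k)).comp
    (envLift (fun x m => S.gen k (S.par x) m)
      (fun x y m => by rw [map_add, gen_add])
      (fun c x m => by rw [map_smul, gen_smul])
      (fun a b x y hx hy m n => by
        have hx' : S.par x ∈ S.gr a := congrArg S.par hx |>.trans (map_smul _ _ _)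
        have hy' : S.par y ∈ S.gr b := congrArg S.par hy |>.trans (map_smul _ _ _)
        rw [S.par_bracket, gen_comm hx' hy', S.form_par])))
    (S.vac k)
    (fun x m hm => by
      rw [AlgHom.comp_apply, envLift_gen]
      exact mode_vac (S.par x) m hm)

/-- The space of fields on `V^k(g)`: sequences `A_(m)`, `m ∈ ℤ`, of endomorphisms such that for
every `v` one has `A_(m) v = 0` for large `m`. -/
def FieldSpace : Submodule ℂ (ℤ → Module.End ℂ (S.Vac k)) where
  carrier := {A | ∀ v, ∀ᶠ m in Filter.atTop, A m v = 0}
  add_mem' := by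
    intro A B hA hB v
    filter_upwards [hA v, hB v] with m h1 h2
    rw [Pi.add_apply, LinearMap.add_apply, h1, h2, add_zero]
  zero_mem' := by intro v; simp
  smul_mem' := by
    intro c A hA v
    filter_upwards [hA v] with m h1
    rw [Pi.smul_apply, LinearMap.smul_apply, h1, smul_zero]

variable {S k}

lemma parVac_vac : S.parVac k (S.vac k) = S.vac k := vacLift_vac _ _ _

lemma parVac_mode (x : g) (m : ℤ) (v : S.Vac k) :
    S.parVac k (S.mode k x m v) = S.mode k (S.par x) m (S.parVac k v) := by
  unfold parVac
  rw [vacLift_mode, AlgHom.comp_apply, envLift_gen]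
  rfl

lemma parVac_parVac (v : S.Vac k) : S.parVac k (S.parVac k v) = v := by
  refine vac_induction (LinearMap.eqLocus (S.parVac k ∘ₗ S.parVac k) LinearMap.id) ?_ ?_ v
  · rw [LinearMap.mem_eqLocus, LinearMap.comp_apply, parVac_vac, parVac_vac]; rfl
  · intro x m v hv
    rw [LinearMap.mem_eqLocus, LinearMap.comp_apply, LinearMap.id_apply] at *
    rw [parVac_mode, parVac_mode, S.par_par, hv]

/-- Signed binomial coefficients `(-1)^j * (m choose j)`. -/
def sbinom (m : ℤ) (j : ℕ) : ℂ := (-1) ^ j * ((Ring.choose m j : ℤ) : ℂ)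

/-- The `j`-th term of the `m`-th product of the field `x(z)` with the field `A`. -/
def nprodTerm (x : g) (m : ℤ) (A : ℤ → Module.End ℂ (S.Vac k)) (n : ℤ) (j : ℕ) :
    Module.End ℂ (S.Vac k) :=
  sbinom m j • (S.mode k x (m - j) ∘ₗ A (n + j) - (-1 : ℂ) ^ m •
    (A (m + n - j) ∘ₗ S.mode k (S.even x) j +
      (S.parVac k ∘ₗ A (m + n - j) ∘ₗ S.parVac k) ∘ₗ S.mode k (S.odd x) j))

lemma nprodTerm_eq_zero {x : g} {m n : ℤ} {A : ℤ → Module.End ℂ (S.Vac k)} {j : ℕ} {v : S.Vac k}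
    (h1 : A (n + j) v = 0) (h2 : ∀ y, S.mode k y j v = 0) : nprodTerm x m A n j v = 0 := by
  simp [nprodTerm, h1, h2]

lemma nprod_support {x : g} {m n : ℤ} {A : ℤ → Module.End ℂ (S.Vac k)} {v : S.Vac k} {N : ℕ}
    (h1 : ∀ j : ℕ, N ≤ j → A (n + j) v = 0) (h2 : ∀ j : ℕ, N ≤ j → ∀ y, S.mode k y j v = 0) :
    (∑ᶠ j : ℕ, nprodTerm x m A n j v) = ∑ j ∈ Finset.range N, nprodTerm x m A n j v := by
  refine finsum_eq_sum_of_support_subset _ ?_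
  intro j hj
  by_contra h
  rw [Finset.coe_range, Set.mem_Iio, not_lt] at h
  exact hj (nprodTerm_eq_zero (h1 j h) (h2 j h))

lemma eventually_mode (v : S.Vac k) :
    ∀ᶠ N : ℕ in Filter.atTop, ∀ j : ℕ, N ≤ j → ∀ y, S.mode k y j v = 0 := by
  filter_upwards [(mode_eventually v).natCast_atTop] with N hN j hj y
  exact hN y j (by exact_mod_cast hj)

lemma eventually_field {A : ℤ → Module.End ℂ (S.Vac k)} (hA : A ∈ S.FieldSpace k) (v : S.Vac k)
    (n : ℤ) : ∀ᶠ N : ℕ in Filter.atTop, ∀ j : ℤ, n + N ≤ j → A j v = 0 := by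
  obtain ⟨N0, h⟩ := Filter.eventually_atTop.1 (hA v)
  filter_upwards [Filter.eventually_ge_atTop (N0 - n).toNat] with N hN j hj
  exact h j (by omega)

/-- The `m`-th product `x(z)_(m) A(z)` of the generating field of `x` with the field `A`:
its `n`-th mode is, for `x` homogeneous,
`∑_(j ≥ 0) (-1)^j (m choose j) (x_(m-j) A_(n+j) - (-1)^(m + |x| |A|) A_(m+n-j) x_(j))`. -/
def nprod (x : g) (m : ℤ) (A : S.FieldSpace k) : S.FieldSpace k :=
  ⟨fun n =>
    { toFun := fun v => ∑ᶠ j : ℕ, nprodTerm x m A.1 n j v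
      map_add' := by
        intro v w
        obtain ⟨N, h1, h2, h3, h4⟩ := ((eventually_mode v).and ((eventually_mode w).and
          ((eventually_field A.2 v n).and (eventually_field A.2 w n)))).exists
        rw [nprod_support (N := N) (fun j hj => h3 _ (by omega)) h1,
          nprod_support (N := N) (fun j hj => h4 _ (by omega)) h2,
          nprod_support (N := N) (v := v + w)
            (fun j hj => by rw [map_add, h3 _ (by omega), h4 _ (by omega), add_zero])
            (fun j hj y => by rw [map_add, h1 j hj, h2 j hj, add_zero]),
          ← Finset.sum_add_distrib]
        simp only [map_add]
      map_smul' := by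
        intro c v
        simp only [map_smul, RingHom.id_apply]
        rw [smul_finsum] },
  by
    intro v
    obtain ⟨J, hJ⟩ := (eventually_mode v).exists
    have h1 : ∀ᶠ n : ℤ in Filter.atTop, ∀ n', n ≤ n' → A.1 n' v = 0 :=
      Filter.eventually_atTop.2 ((Filter.eventually_atTop.1 (A.2 v)).imp
        fun a h b hb n' hn => h _ (hb.trans hn))
    have h2 : ∀ᶠ n : ℤ in Filter.atTop, ∀ j ∈ Finset.range J,
        A.1 (m + n - j) (S.mode k (S.even x) j v) = 0 ∧
        A.1 (m + n - j) (S.parVac k (S.mode k (S.odd x) j v)) = 0 := by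
      rw [Filter.eventually_all_finset]
      intro j _
      have ht : Filter.Tendsto (fun n : ℤ => m + n - j) Filter.atTop Filter.atTop :=
        Filter.tendsto_atTop_atTop.2 fun b => ⟨b - m + j, fun a ha => by omega⟩
      exact (ht.eventually (A.2 _)).and (ht.eventually (A.2 _))
    filter_upwards [h1, h2] with n hn1 hn2
    change (∑ᶠ j : ℕ, nprodTerm x m A.1 n j v) = 0
    rw [nprod_support (N := J) (fun j _ => hn1 _ (by omega)) hJ]
    refine Finset.sum_eq_zero fun j hj => ?_
    have := hn2 j hj
    simp [nprodTerm, hn1 (n + j) (by omega), this.1, this.2]⟩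

lemma nprod_apply (x : g) (m : ℤ) (A : S.FieldSpace k) (n : ℤ) (v : S.Vac k) :
    (nprod x m A).1 n v = ∑ᶠ j : ℕ, nprodTerm x m A.1 n j v := rfl

lemma nprod_ext {A B : S.FieldSpace k} (h : ∀ n v, A.1 n v = B.1 n v) : A = B :=
  Subtype.ext (funext fun n => LinearMap.ext fun v => h n v)

/-- `nprod` as a linear map in the field. -/
def nprodLin (x : g) (m : ℤ) : Module.End ℂ (S.FieldSpace k) where
  toFun := nprod x m
  map_add' := by
    intro A B
    refine nprod_ext fun n v => ?_
    obtain ⟨N, h1, h2, h3⟩ := ((eventually_mode v).and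
      ((eventually_field A.2 v n).and (eventually_field B.2 v n))).exists
    change _ = (nprod x m A).1 n v + (nprod x m B).1 n v
    simp only [nprod_apply]
    rw [nprod_support (N := N) (fun j hj => h2 _ (by omega)) h1,
      nprod_support (N := N) (fun j hj => h3 _ (by omega)) h1,
      nprod_support (N := N) (A := (A + B).1)
        (fun j hj => by
          change A.1 _ v + B.1 _ v = 0
          rw [h2 _ (by omega), h3 _ (by omega), add_zero]) h1,
      ← Finset.sum_add_distrib]
    refine Finset.sum_congr rfl fun j _ => ?_
    simp only [nprodTerm, Submodule.coe_add, Pi.add_apply, LinearMap.add_comp, LinearMap.comp_add,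
      LinearMap.smul_apply, LinearMap.sub_apply, LinearMap.add_apply, LinearMap.comp_apply]
    module
  map_smul' := by
    intro c A
    refine nprod_ext fun n v => ?_
    change _ = c • (nprod x m A).1 n v
    simp only [nprod_apply]
    rw [smul_finsum]
    refine finsum_congr fun j => ?_
    simp only [nprodTerm, Submodule.coe_smul, Pi.smul_apply, LinearMap.smul_comp,
      LinearMap.comp_smul,
      LinearMap.smul_apply, LinearMap.sub_apply, LinearMap.add_apply, LinearMap.comp_apply]
    module

/-- Conjugation of a field by the parity automorphism. -/
def twist (A : S.FieldSpace k) : S.FieldSpace k :=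
  ⟨fun n => S.parVac k ∘ₗ A.1 n ∘ₗ S.parVac k, by
    intro v
    filter_upwards [A.2 (S.parVac k v)] with n h
    simp [h]⟩

/-- The sign twist by an element of parity `a`. -/
def tw (a : ZMod 2) (A : S.FieldSpace k) : S.FieldSpace k := if a = 1 then twist A else A

lemma even_of_mem {x : g} (h : x ∈ S.gr 0) : S.even x = x ∧ S.odd x = 0 := by
  have h : S.par x = x := by simpa [koszul] using (show S.par x = koszul 0 1 • x from h)
  simp only [even, odd, LinearMap.smul_apply, LinearMap.add_apply, LinearMap.sub_apply,
    LinearMap.id_apply, h, sub_self, smul_zero, and_true]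
  rw [← two_smul ℂ x, smul_smul]; norm_num

lemma odd_of_mem {x : g} (h : x ∈ S.gr 1) : S.even x = 0 ∧ S.odd x = x := by
  have h : S.par x = -x := by simpa [koszul] using (show S.par x = koszul 1 1 • x from h)
  simp only [even, odd, LinearMap.smul_apply, LinearMap.add_apply, LinearMap.sub_apply,
    LinearMap.id_apply, h, add_neg_cancel, smul_zero, true_and, sub_neg_eq_add]
  rw [← two_smul ℂ x, smul_smul]; norm_num

lemma zmod_two (a : ZMod 2) : a = 0 ∨ a = 1 := by
  fin_cases a
  · exact Or.inl rfl
  · exact Or.inr rfl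

lemma mode_zero (m : ℤ) : S.mode k 0 m = 0 := by
  simpa using mode_smul (S := S) (k := k) 0 0 m

lemma nprod_eq_sum {a : ZMod 2} {x : g} (hx : x ∈ S.gr a) {m n : ℤ} {A : S.FieldSpace k} {v : S.Vac k}
    {N : ℕ} (h1 : ∀ j : ℤ, n + N ≤ j → A.1 j v = 0)
    (h2 : ∀ j : ℕ, N ≤ j → ∀ y, S.mode k y j v = 0) :
    (nprod x m A).1 n v = ∑ j ∈ Finset.range N, sbinom m j •
      (S.mode k x (m - j) (A.1 (n + j) v)
        - (-1 : ℂ) ^ m • (tw a A).1 (m + n - j) (S.mode k x j v)) := by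
  rw [nprod_apply, nprod_support (fun j hj => h1 _ (by omega)) h2]
  refine Finset.sum_congr rfl fun j _ => ?_
  rcases zmod_two a with rfl | rfl
  · simp [nprodTerm, even_of_mem hx, tw, mode_zero]
  · simp [nprodTerm, odd_of_mem hx, tw, mode_zero, twist]

lemma tw_tw (a b : ZMod 2) (A : S.FieldSpace k) : tw a (tw b A) = tw b (tw a A) := by
  unfold tw; split_ifs <;> rfl

lemma tw_nprod {a b : ZMod 2} {x : g} (hx : x ∈ S.gr a) (m : ℤ) (A : S.FieldSpace k) :
    tw b (nprod x m A) = koszul a b • nprod x m (tw b A) := by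
  rcases zmod_two b with rfl | rfl
  · simp [tw, koszul]
  · refine nprod_ext fun n v => ?_
    change S.parVac k ((nprod x m A).1 n (S.parVac k v))
      = koszul a 1 • (nprod x m (twist A)).1 n v
    have hx' : S.par x = koszul a 1 • x := hx
    have hk : koszul a 1 * koszul a 1 = 1 := by unfold koszul; split_ifs <;> norm_num
    obtain ⟨N, h1, h2, h3⟩ := ((eventually_mode v).and ((eventually_mode (S.parVac k v)).and
      (eventually_field A.2 (S.parVac k v) n))).exists
    rw [nprod_eq_sum hx h3 h2, nprod_eq_sum hx (A := twist A) (N := N) ?_ h1, map_sum,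
      Finset.smul_sum]
    · refine Finset.sum_congr rfl fun j _ => ?_
      have e1 : S.parVac k (S.mode k x (m - j) (A.1 (n + j) (S.parVac k v))) =
          koszul a 1 • S.mode k x (m - j) ((twist A).1 (n + j) v) := by
        rw [parVac_mode, hx', mode_smul]; rfl
      have e2 : S.parVac k ((tw a A).1 (m + n - j) (S.mode k x j (S.parVac k v))) =
          koszul a 1 • (tw a (twist A)).1 (m + n - j) (S.mode k x j v) := by
        have : S.mode k x j (S.parVac k v) = koszul a 1 • S.parVac k (S.mode k x j v) := by
          rw [parVac_mode, hx', mode_smul, LinearMap.smul_apply, smul_smul, hk, one_smul]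
        rw [this, map_smul, map_smul]
        congr 1
        rcases zmod_two a with rfl | rfl
        · rfl
        · rfl
      rw [map_smul, map_sub, map_smul, e1, e2]
      module
    · intro j hj
      change S.parVac k (A.1 j (S.parVac k v)) = 0
      rw [h3 j hj, map_zero]

lemma choose_mul_sub (m : ℤ) (j : ℕ) :
    Ring.choose m j * (m - j) = m * Ring.choose (m - 1) j := by
  have h := Ring.descPochhammer_eq_factorial_smul_choose m (j + 1)
  have h1 := Ring.descPochhammer_eq_factorial_smul_choose m j
  have h2 := Ring.descPochhammer_eq_factorial_smul_choose (m - 1) j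
  have e1 : (descPochhammer ℤ (j + 1)).smeval m = (descPochhammer ℤ j).smeval m * (m - j) := by
    rw [← Polynomial.eval_eq_smeval, ← Polynomial.eval_eq_smeval, descPochhammer_succ_right]
    simp
  have e2 : (descPochhammer ℤ (j + 1)).smeval m = m * (descPochhammer ℤ j).smeval (m - 1) := by
    rw [← Polynomial.eval_eq_smeval, ← Polynomial.eval_eq_smeval, descPochhammer_succ_left]
    simp
  rw [e2, h2] at e1
  rw [h1] at e1
  simp only [nsmul_eq_mul] at e1
  have hj : ((j.factorial : ℕ) : ℤ) ≠ 0 := by exact_mod_cast j.factorial_ne_zero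
  refine mul_left_cancel₀ hj ?_
  linear_combination -e1

lemma sbinom_mul_sub (m : ℤ) (j : ℕ) : sbinom m j * (m - j) = m * sbinom (m - 1) j := by
  have h := congrArg (fun z : ℤ => (-1 : ℂ) ^ j * (z : ℂ)) (choose_mul_sub m j)
  push_cast at h
  unfold sbinom
  linear_combination h

lemma sbinom_add (m n : ℤ) (s : ℕ) :
    sbinom (m + n) s = ∑ p ∈ Finset.HasAntidiagonal.antidiagonal s, sbinom m p.1 * sbinom n p.2 := by
  unfold sbinom
  rw [Ring.add_choose_eq s (Commute.all m n), Int.cast_sum, Finset.mul_sum]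
  refine Finset.sum_congr rfl fun p hp => ?_
  rw [← Finset.HasAntidiagonal.mem_antidiagonal.1 hp, pow_add]
  push_cast
  ring

lemma sum_sbinom {V : Type} [AddCommGroup V] [Module ℂ V] (m n : ℤ) (F : ℕ → V) (N : ℕ)
    (hF : ∀ s, N ≤ s → F s = 0) :
    ∑ j ∈ Finset.range N, ∑ i ∈ Finset.range N, (sbinom m j * sbinom n i) • F (j + i) =
      ∑ s ∈ Finset.range N, sbinom (m + n) s • F s := by
  rw [← Finset.sum_product' (Finset.range N) (Finset.range N)
      (fun j i => (sbinom m j * sbinom n i) • F (j + i)),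
    ← Finset.sum_filter_of_ne (p := fun p => p.1 + p.2 ∈ Finset.range N),
    ← Finset.sum_fiberwise_of_maps_to (t := Finset.range N) (g := fun p => p.1 + p.2)]
  · refine Finset.sum_congr rfl fun s hs => ?_
    rw [sbinom_add, Finset.sum_smul]
    refine Finset.sum_congr ?_ fun p hp => ?_
    · ext p
      simp only [Finset.mem_filter, Finset.mem_product, Finset.mem_range,
        Finset.HasAntidiagonal.mem_antidiagonal] at *
      omega
    · rw [Finset.HasAntidiagonal.mem_antidiagonal.1 hp]
  · intro p hp
    exact (Finset.mem_filter.1 hp).2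
  · intro p _ hp
    by_contra h
    rw [Finset.mem_range, not_lt] at h
    exact hp (by rw [hF _ h, smul_zero])

lemma eventually_unif (B : S.FieldSpace k) (x : g) (c : ℤ) (v : S.Vac k) :
    ∀ᶠ N : ℕ in Filter.atTop, ∀ j : ℕ,
      (∀ q : ℤ, c - j + N ≤ q → B.1 q (S.mode k x j v) = 0) ∧
      (∀ i : ℕ, N ≤ i → ∀ y, S.mode k y i (S.mode k x j v) = 0) := by
  obtain ⟨J, hJ⟩ := (eventually_mode v).exists
  have h : ∀ᶠ N : ℕ in Filter.atTop, ∀ j ∈ Finset.range J,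
      (∀ q : ℤ, c - j + N ≤ q → B.1 q (S.mode k x j v) = 0) ∧
      (∀ i : ℕ, N ≤ i → ∀ y, S.mode k y i (S.mode k x j v) = 0) := by
    rw [Filter.eventually_all_finset]
    intro j _
    exact (eventually_field B.2 _ _).and (eventually_mode _)
  filter_upwards [h] with N hN j
  by_cases hj : j < J
  · exact hN j (Finset.mem_range.2 hj)
  · rw [hJ j (by omega) x]
    simp

lemma koszul_symm (a b : ZMod 2) : koszul a b = koszul b a := by
  unfold koszul; simp only [and_comm]

lemma koszul_mul_self (a b : ZMod 2) : koszul a b * koszul a b = 1 := by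
  unfold koszul; split_ifs <;> norm_num

lemma koszul_add (a b : ZMod 2) : koszul (a + b) 1 = koszul a 1 * koszul b 1 := by
  rcases zmod_two a with rfl | rfl <;> rcases zmod_two b with rfl | rfl <;> 
    simp [koszul, show (1 : ZMod 2) + 1 = 0 from rfl]

lemma bracket_mem {a b : ZMod 2} {x y : g} (hx : x ∈ S.gr a) (hy : y ∈ S.gr b) :
    S.bracket x y ∈ S.gr (a + b) := by
  change S.par _ = _
  have hx' : S.par x = koszul a 1 • x := hx
  have hy' : S.par y = koszul b 1 • y := hy
  rw [S.par_bracket, hx', hy', koszul_add, map_smul, map_smul, LinearMap.smul_apply, smul_smul,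
    mul_comm]

lemma tw_add (a b : ZMod 2) (A : S.FieldSpace k) : tw (a + b) A = tw b (tw a A) := by
  rcases zmod_two a with rfl | rfl <;> rcases zmod_two b with rfl | rfl
  · rfl
  · simp [tw]
  · simp [tw]
  · refine nprod_ext fun n v => ?_
    change A.1 n v = S.parVac k (S.parVac k (A.1 n (S.parVac k (S.parVac k v))))
    rw [parVac_parVac, parVac_parVac]

/-- One of the two iterated products, expanded at a common truncation. -/
lemma nprod_nprod {a b : ZMod 2} {x y : g} (hx : x ∈ S.gr a) (hy : y ∈ S.gr b) (m n l : ℤ)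
    (A : S.FieldSpace k) (v : S.Vac k) :
    ∀ᶠ N : ℕ in Filter.atTop, (nprod x m (nprod y n A)).1 l v =
      ∑ j ∈ Finset.range N, ∑ i ∈ Finset.range N, (sbinom m j * sbinom n i) •
        (S.mode k x (m - j) (S.mode k y (n - i) (A.1 (l + j + i) v))
          - (-1 : ℂ) ^ n • S.mode k x (m - j) ((tw b A).1 (n + l + j - i) (S.mode k y i v))
          - ((-1 : ℂ) ^ m * koszul a b) •
            S.mode k y (n - i) ((tw a A).1 (m + l - j + i) (S.mode k x j v))
          + ((-1 : ℂ) ^ m * (-1 : ℂ) ^ n * koszul a b) •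
            (tw (a + b) A).1 (m + n + l - j - i) (S.mode k y i (S.mode k x j v))) := by
  filter_upwards [eventually_field A.2 v l, eventually_mode v,
    eventually_field (nprod y n A).2 v l, eventually_unif (tw a A) x (m + l) v] with N h1 h2 h3 h4
  rw [nprod_eq_sum hx h3 h2]
  refine Finset.sum_congr rfl fun j _ => ?_
  rw [tw_nprod hy, koszul_symm b a]
  change sbinom m j • (S.mode k x (m - j) ((nprod y n A).1 (l + j) v) - (-1 : ℂ) ^ m •
    koszul a b • (nprod y n (tw a A)).1 (m + l - j) (S.mode k x j v)) = _
  rw [nprod_eq_sum hy (N := N) (fun q hq => h1 q (by omega)) h2,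
    nprod_eq_sum hy (N := N) (h4 j).1 (h4 j).2, map_sum]
  simp only [Finset.smul_sum, ← Finset.sum_sub_distrib]
  refine Finset.sum_congr rfl fun i _ => ?_
  rw [map_smul, map_sub, map_smul, ← tw_add,
    show n + (l + (j : ℤ)) - i = n + l + j - i by ring,
    show n + (m + l - (j : ℤ)) - i = m + n + l - j - i by ring]
  module

lemma nprod_comm {a b : ZMod 2} {x y : g} (hx : x ∈ S.gr a) (hy : y ∈ S.gr b) (m n : ℤ)
    (A : S.FieldSpace k) :
    nprod x m (nprod y n A) = koszul a b • nprod y n (nprod x m A)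
      + nprod (S.bracket x y) (m + n) A
      + (if m + n = 0 then k * m * S.form x y else 0) • A := by
  refine nprod_ext fun l v => ?_
  change _ = koszul a b • (nprod y n (nprod x m A)).1 l v
    + (nprod (S.bracket x y) (m + n) A).1 l v
    + (if m + n = 0 then k * m * S.form x y else 0) • A.1 l v
  obtain ⟨N, h1, h2, h3, h4, hN⟩ := ((nprod_nprod hx hy m n l A v).and
    ((nprod_nprod hy hx n m l A v).and ((eventually_field A.2 v l).and
    ((eventually_mode v).and (Filter.eventually_ge_atTop 1))))).exists
  rw [h1, h2, nprod_eq_sum (bracket_mem hx hy) h3 h4, Finset.sum_comm (s := Finset.range N)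
    (f := fun i j => (sbinom n i * sbinom m j) • _)]
  have hF := sum_sbinom m n (fun s => S.mode k (S.bracket x y) (m + n - s) (A.1 (l + s) v)
    - (-1 : ℂ) ^ (m + n) • (tw (a + b) A).1 (m + n + l - s) (S.mode k (S.bracket x y) s v)) N
    (fun s hs => by simp only [h3 (l + s) (by omega), h4 s hs]; simp)
  have hG := sum_sbinom (m - 1) n (fun s => (if m + n - s = 0 then k * m * S.form x y else 0) •
    A.1 (l + s) v) N (fun s hs => by simp only [h3 (l + s) (by omega)]; simp)
  have hG' : ∑ s ∈ Finset.range N, sbinom (m - 1 + n) s •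
      (if m + n - s = 0 then k * m * S.form x y else 0) • A.1 (l + s) v =
      (if m + n = 0 then k * m * S.form x y else 0) • A.1 l v := by
    rw [Finset.sum_eq_single_of_mem 0 (Finset.mem_range.2 hN)]
    · simp [sbinom]
    · intro s _ hs
      split_ifs with h
      · have : sbinom (m - 1 + n) s = 0 := by
          rw [show m - 1 + n = ((s - 1 : ℕ) : ℤ) by omega, sbinom, Ring.choose_natCast,
            Nat.choose_eq_zero_of_lt (by omega)]
          simp
        rw [this, zero_smul]
      · simp
  rw [← hF, ← hG', ← hG, Finset.smul_sum, ← Finset.sum_add_distrib, ← Finset.sum_add_distrib]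
  refine Finset.sum_congr rfl fun j _ => ?_
  rw [Finset.smul_sum, ← Finset.sum_add_distrib, ← Finset.sum_add_distrib]
  refine Finset.sum_congr rfl fun i _ => ?_
  have hT1 := mode_comm (k := k) hx hy (m - j) (n - i) (A.1 (l + j + i) v)
  have hT4 := mode_comm (k := k) hx hy j i v
  have h0 : (if (j : ℤ) + i = 0 then k * ((j : ℤ) : ℂ) * S.form x y else 0) = 0 := by
    split_ifs with h
    · rw [show (j : ℤ) = 0 by omega]; simp
    · rfl
  rw [h0, zero_smul, add_zero] at hT4
  rw [hT1, hT4, show l + (i : ℤ) + j = l + j + i by ring,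
    show m + l + (i : ℤ) - j = m + l - j + i by ring,
    show n + l + (j : ℤ) - i = n + l - i + j by ring,
    show n + m + l - (i : ℤ) - j = m + n + l - j - i by ring, add_comm b a]
  push_cast
  rw [show l + ((j : ℤ) + i) = l + j + i by ring,
    show m + n - ((j : ℤ) + i) = m - j + (n - i) by ring,
    show m + n + l - ((j : ℤ) + i) = m + n + l - j - i by ring,
    zpow_add₀ (by norm_num : (-1 : ℂ) ≠ 0), koszul_symm b a]
  have hc : (sbinom m j * sbinom n i) * (if m - (j : ℤ) + (n - i) = 0 then
      k * ((m : ℂ) - j) * S.form x y else 0) = (sbinom (m - 1) j * sbinom n i) *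
      (if m - (j : ℤ) + (n - i) = 0 then k * m * S.form x y else 0) := by
    split_ifs with h
    · linear_combination (sbinom n i * k * S.form x y) * sbinom_mul_sub m j
    · simp
  simp only [map_add, map_smul, smul_add, smul_sub, smul_smul, ← hc]
  rcases (show koszul a b = 1 ∨ koszul a b = -1 by unfold koszul; split_ifs <;> simp) with h | h <;>
    rw [h] <;> module

lemma nprod_add (x y : g) (m : ℤ) (A : S.FieldSpace k) :
    nprod (x + y) m A = nprod x m A + nprod y m A := by
  refine nprod_ext fun n v => ?_
  obtain ⟨N, h1, h2⟩ := ((eventually_mode v).and (eventually_field A.2 v n)).exists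
  change _ = (nprod x m A).1 n v + (nprod y m A).1 n v
  simp only [nprod_apply]
  rw [nprod_support (N := N) (fun j hj => h2 _ (by omega)) h1,
    nprod_support (N := N) (fun j hj => h2 _ (by omega)) h1,
    nprod_support (N := N) (fun j hj => h2 _ (by omega)) h1, ← Finset.sum_add_distrib]
  refine Finset.sum_congr rfl fun j _ => ?_
  simp only [nprodTerm, mode_add, LinearMap.comp_apply, LinearMap.smul_apply, LinearMap.sub_apply,
    LinearMap.add_apply, map_add]
  module

lemma nprod_smul (c : ℂ) (x : g) (m : ℤ) (A : S.FieldSpace k) :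
    nprod (c • x) m A = c • nprod x m A := by
  refine nprod_ext fun n v => ?_
  change _ = c • (nprod x m A).1 n v
  simp only [nprod_apply]
  rw [smul_finsum]
  refine finsum_congr fun j => ?_
  simp only [nprodTerm, mode_smul, LinearMap.comp_apply, LinearMap.smul_apply, LinearMap.sub_apply,
    LinearMap.add_apply, map_smul]
  module

variable (S k)

/-- The action of the affinization of `g` on fields by `x ⊗ t ^ m ↦ x(z)_(m)`. -/
def fieldRep : S.Env k →ₐ[ℂ] Module.End ℂ (S.FieldSpace k) :=
  envLift nprodLin
    (fun x y m => LinearMap.ext fun A => nprod_add x y m A)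
    (fun c x m => LinearMap.ext fun A => nprod_smul c x m A)
    (fun _ _ _ _ hx hy m n => LinearMap.ext fun A => nprod_comm hx hy m n A)

lemma fieldRep_gen (x : g) (m : ℤ) : S.fieldRep k (S.gen k x m) = nprodLin x m :=
  envLift_gen _ _ _ _ _ _

/-- The field of the vacuum: the identity, `(id)_(m) = δ_(m, -1)`. -/
def idField : S.FieldSpace k :=
  ⟨fun m => if m = -1 then 1 else 0, by
    intro v
    filter_upwards [Filter.eventually_ge_atTop 0] with m hm
    rw [if_neg (by omega)]; rfl⟩

variable {S k}

lemma idField_apply (m : ℤ) (v : S.Vac k) :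
    (S.idField k).1 m v = if m = -1 then v else 0 := by
  change (if m = -1 then (1 : Module.End ℂ (S.Vac k)) else 0) v = _
  split_ifs <;> rfl

lemma tw_idField (a : ZMod 2) : tw a (S.idField k) = S.idField k := by
  unfold tw
  split_ifs
  · refine nprod_ext fun n v => ?_
    change S.parVac k ((S.idField k).1 n (S.parVac k v)) = _
    rw [idField_apply, idField_apply]
    split_ifs
    · exact parVac_parVac v
    · exact map_zero _
  · rfl

lemma nprod_idField (x : g) (m : ℤ) (hm : 0 ≤ m) : nprod x m (S.idField k) = 0 := by
  have key : ∀ (a : ZMod 2) (x : g), x ∈ S.gr a → nprod x m (S.idField k) = 0 := by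
    intro a x hx
    refine nprod_ext fun n v => ?_
    obtain ⟨N, h1, h2, hN⟩ := ((eventually_mode v).and ((eventually_field (S.idField k).2 v n).and
      (Filter.eventually_ge_atTop ((-1 - n).toNat + (m + n + 1).toNat + 1)))).exists
    rw [nprod_eq_sum hx h2 h1, tw_idField]
    change _ = (0 : S.Vac k)
    obtain ⟨m, rfl⟩ := Int.eq_ofNat_of_zero_le hm
    simp only [idField_apply, smul_sub, Finset.sum_sub_distrib]
    by_cases hn : n + 1 ≤ 0 ∧ 0 ≤ m + n + 1
    · obtain ⟨p, hp⟩ := Int.eq_ofNat_of_zero_le (show 0 ≤ -1 - n by omega)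
      obtain ⟨q, hq⟩ := Int.eq_ofNat_of_zero_le hn.2
      obtain rfl : m = p + q := by omega
      rw [Finset.sum_eq_single_of_mem p (Finset.mem_range.2 (by omega)),
        Finset.sum_eq_single_of_mem q (Finset.mem_range.2 (by omega)), if_pos (by omega),
        if_pos (by omega), show ((p + q : ℕ) : ℤ) - p = q by push_cast; ring, sub_eq_zero,
        smul_smul]
      · congr 1
        unfold sbinom
        rw [Ring.choose_natCast, Ring.choose_natCast, Nat.choose_symm_add, zpow_natCast, pow_add]
        have hs : ((-1 : ℂ) ^ q) * (-1) ^ q = 1 := by rw [← mul_pow]; norm_num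
        linear_combination (-(-1 : ℂ) ^ p * (((p + q).choose q : ℤ) : ℂ)) * hs
      · intro j _ hj
        rw [if_neg (by omega), smul_zero, smul_zero]
      · intro j _ hj
        rw [if_neg (by omega), map_zero, smul_zero]
    · rw [Finset.sum_eq_zero, Finset.sum_eq_zero, sub_zero]
      · intro j _
        split_ifs with h
        · rw [sbinom, Ring.choose_natCast, Nat.choose_eq_zero_of_lt (by omega)]
          simp
        · simp
      · intro j _
        split_ifs with h
        · rw [sbinom, Ring.choose_natCast, Nat.choose_eq_zero_of_lt (by omega)]
          simp
        · simp
  rw [← even_add_odd (S := S) x, nprod_add, key 0 _ (even_mem x), key 1 _ (odd_mem x), add_zero]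

variable (S k)

/-- The state-field correspondence of `V^k(g)`: `Y a n` is the mode `a_(n)` of the field
`a(z) = ∑ a_(n) z ^ (-n - 1)`. It is determined by `Y |0> = id` and
`Y (x_(m) a) = x(z)_(m) Y(a)`. -/
def fieldMap : S.Vac k →ₗ[ℂ] S.FieldSpace k :=
  vacLift (S.fieldRep k) (S.idField k) (fun x m hm => by
    rw [fieldRep_gen]
    exact nprod_idField x m hm)

/-- The mode `a_(n)` of the state `a`. -/
def Y (a : S.Vac k) (n : ℤ) : Module.End ℂ (S.Vac k) := (S.fieldMap k a).1 n

variable {S k}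

lemma fieldMap_vac : S.fieldMap k (S.vac k) = S.idField k := vacLift_vac _ _ _

lemma fieldMap_mode (x : g) (m : ℤ) (a : S.Vac k) :
    S.fieldMap k (S.mode k x m a) = nprod x m (S.fieldMap k a) := by
  unfold fieldMap
  rw [vacLift_mode, fieldRep_gen]
  rfl

lemma Y_generator (x : g) (n : ℤ) : S.Y k (S.mode k x (-1) (S.vac k)) n = S.mode k x n := by
  have key : ∀ (a : ZMod 2) (x : g), x ∈ S.gr a → ∀ v,
      (nprod x (-1) (S.idField k)).1 n v = S.mode k x n v := by
    intro a x hx v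
    obtain ⟨N, h1, h2, hN⟩ := ((eventually_mode v).and ((eventually_field (S.idField k).2 v n).and
      (Filter.eventually_ge_atTop ((-1 - n).toNat + n.toNat + 1)))).exists
    have hs : ∀ j, sbinom (-1) j = 1 := by
      intro j
      rw [sbinom, Ring.choose_neg', Ring.multichoose_one]
      rcases Nat.even_or_odd j with hj | hj
      · rw [Int.negOnePow_even _ (by exact_mod_cast hj), hj.neg_one_pow]; simp
      · rw [Int.negOnePow_odd _ (by exact_mod_cast hj), hj.neg_one_pow]; simp
    rw [nprod_eq_sum hx h2 h1, tw_idField]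
    simp only [idField_apply, hs, one_smul, Finset.sum_sub_distrib]
    rcases le_or_gt 0 n with hn | hn
    · obtain ⟨n, rfl⟩ := Int.eq_ofNat_of_zero_le hn
      rw [Finset.sum_eq_zero, Finset.sum_eq_single_of_mem n (Finset.mem_range.2 (by omega)),
        if_pos (by omega)]
      · simp
      · intro j _ hj
        rw [if_neg (by omega), smul_zero]
      · intro j _
        rw [if_neg (by omega), map_zero]
    · obtain ⟨p, hp⟩ := Int.eq_ofNat_of_zero_le (show 0 ≤ -1 - n by omega)
      rw [Finset.sum_eq_single_of_mem p (Finset.mem_range.2 (by omega)), Finset.sum_eq_zero,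
        if_pos (by omega), sub_zero, show (-1 : ℤ) - p = n by omega]
      · intro j _
        rw [if_neg (by omega), smul_zero]
      · intro j _ hj
        rw [if_neg (by omega), map_zero]
  refine LinearMap.ext fun v => ?_
  change (S.fieldMap k _).1 n v = _
  rw [fieldMap_mode, fieldMap_vac, ← even_add_odd (S := S) x, nprod_add, mode_add]
  exact congrArg₂ (· + ·) (key 0 _ (even_mem x) v) (key 1 _ (odd_mem x) v)

variable (S k)

/-- The translation operator `T a = a_(-2) |0>`. -/
def T (a : S.Vac k) : S.Vac k := S.Y k a (-2) (S.vac k)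

/-- The submodule of `V^k(g)` generated by the vector `v`, i.e. the smallest subspace that contains
`v` and is stable under all modes `x_(m)` and under the translation operator. -/
def generated (v : S.Vac k) : Submodule ℂ (S.Vac k) :=
  sInf {W | v ∈ W ∧ (∀ x m, ∀ w ∈ W, S.mode k x m w ∈ W) ∧ ∀ w ∈ W, S.T k w ∈ W}

variable {k}

/-- The subspace `C_2(V)` for the quotient `V = V^k(g) / U`, spanned by the vectors `x_(-m) v` with
`m ≥ 2`, `x` a strong generator and `v ∈ V`. -/
def C2 (U : Submodule ℂ (S.Vac k)) : Submodule ℂ (S.Vac k ⧸ U) :=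
  Submodule.span ℂ {w | ∃ (x : g) (m : ℤ) (v : S.Vac k), 2 ≤ m ∧ w = U.mkQ (S.mode k x (-m) v)}

/-- The underlying space of Zhu's `C_2`-algebra `R_V = V / C_2(V)` of `V = V^k(g) / U`. -/
abbrev Zhu (U : Submodule ℂ (S.Vac k)) : Type := (S.Vac k ⧸ U) ⧸ S.C2 U

/-- The class in `R_V` of (the image in `V = V^k(g) / U` of) a state. -/
def toZhu (U : Submodule ℂ (S.Vac k)) : S.Vac k →ₗ[ℂ] S.Zhu U := (S.C2 U).mkQ ∘ₗ U.mkQ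

/-- A character of the `C_2`-algebra `R_V`, `V = V^k(g) / U`: a unital linear functional which is
multiplicative for the product `[a] * [b] = [a_(-1) b]`. -/
structure IsCharacter (U : Submodule ℂ (S.Vac k)) (φ : S.Zhu U →ₗ[ℂ] ℂ) : Prop where
  map_one : φ (S.toZhu U (S.vac k)) = 1
  map_mul : ∀ a b : S.Vac k,
    φ (S.toZhu U (S.Y k a (-1) b)) = φ (S.toZhu U a) * φ (S.toZhu U b)

/-- The associated variety `specm R_V` of `V = V^k(g) / U` as a set of points of `g^*`. The algebra
`R_V` is generated by the classes of the strong generators `x_(-1) |0>`, `x ∈ g`; hence its maximal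
ideals are the kernels of its characters `R_V → ℂ`, and a character is determined by the linear
functional on `g` of its values on these generators (this functional vanishes on the odd part of
`g`, whose elements give nilpotent elements of `R_V`). -/
def assocVariety (U : Submodule ℂ (S.Vac k)) : Set (Module.Dual ℂ g) :=
  {l | ∃ φ : S.Zhu U →ₗ[ℂ] ℂ, S.IsCharacter U φ ∧
    ∀ x : g, l x = φ (S.toZhu U (S.mode k x (-1) (S.vac k)))}

end LieSuperalgebra
end Affine

namespace PSL

open Affine

/-- Supermatrices acting on `ℂ^(n|n)`; the indices `inl i` are even and the `inr i` are odd. -/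
abbrev Mat (n : ℕ) : Type := Matrix (Fin n ⊕ Fin n) (Fin n ⊕ Fin n) ℂ

/-- The grading operator of `ℂ^(n|n)`. -/
def gr (n : ℕ) : Mat n := Matrix.fromBlocks 1 0 0 (-1)

lemma gr_gr (n : ℕ) : gr n * gr n = 1 := by
  simp [gr, Matrix.fromBlocks_multiply, ← Matrix.fromBlocks_one]

lemma gr_gr_mul (n : ℕ) (X : Mat n) : gr n * (gr n * X) = X := by
  rw [← mul_assoc, gr_gr, one_mul]

/-- The supertrace: the trace of the upper left minus the trace of the lower right block. -/
def str (n : ℕ) : Mat n →ₗ[ℂ] ℂ where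
  toFun X := X.toBlocks₁₁.trace - X.toBlocks₂₂.trace
  map_add' X Y := by
    simp only [Matrix.trace, Matrix.diag_apply, Matrix.toBlocks₁₁, Matrix.toBlocks₂₂,
      Matrix.of_apply, Matrix.add_apply, Finset.sum_add_distrib]
    ring
  map_smul' c X := by
    simp only [Matrix.trace, Matrix.diag_apply, Matrix.toBlocks₁₁, Matrix.toBlocks₂₂,
      Matrix.of_apply, Matrix.smul_apply, smul_eq_mul, ← Finset.mul_sum, RingHom.id_apply]
    ring

lemma str_eq (n : ℕ) (X : Mat n) : str n X = (gr n * X).trace := by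
  conv_rhs => rw [← Matrix.fromBlocks_toBlocks X]
  simp [gr, str, Matrix.fromBlocks_multiply, Matrix.trace, sub_eq_add_neg]

/-- The parity automorphism: it changes the sign of the two off-diagonal blocks. -/
def par (n : ℕ) : Mat n →ₗ[ℂ] Mat n :=
  LinearMap.mulLeft ℂ (gr n) ∘ₗ LinearMap.mulRight ℂ (gr n)

lemma par_apply (n : ℕ) (X : Mat n) : par n X = gr n * (X * gr n) := rfl

lemma par_par (n : ℕ) (X : Mat n) : par n (par n X) = X := by
  rw [par_apply, par_apply, mul_assoc, mul_assoc, gr_gr, mul_one, gr_gr_mul]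

lemma par_mul (n : ℕ) (X Y : Mat n) : par n (X * Y) = par n X * par n Y := by
  simp only [par_apply, mul_assoc, gr_gr_mul]

lemma par_one (n : ℕ) : par n 1 = 1 := by rw [par_apply, one_mul, gr_gr]

lemma str_par (n : ℕ) (X : Mat n) : str n (par n X) = str n X := by
  rw [str_eq, str_eq, par_apply, gr_gr_mul, Matrix.trace_mul_comm]

/-- The superbracket of supermatrices. For homogeneous `X` and `Y` it is
`X * Y - (-1)^(|X| |Y|) Y * X`. -/
def bracket (n : ℕ) : Mat n →ₗ[ℂ] Mat n →ₗ[ℂ] Mat n :=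
  LinearMap.mk₂ ℂ (fun X Y => X * Y
      - ((2⁻¹ : ℂ) • (Y + par n Y) * X + (2⁻¹ : ℂ) • (Y - par n Y) * par n X))
    (fun X X' Y => by simp only [map_add, add_mul, mul_add]; abel)
    (fun c X Y => by
      simp only [map_smul, Matrix.smul_mul, Matrix.mul_smul, smul_sub, smul_add])
    (fun X Y Y' => by simp only [map_add, smul_add, smul_sub, add_mul, mul_add, sub_mul]; abel)
    (fun c X Y => by
      simp only [map_smul, Matrix.smul_mul, Matrix.mul_smul, smul_sub, smul_add,
        smul_comm c (2⁻¹ : ℂ), add_mul, sub_mul])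

/-- The sign twist by an element of parity `a`. -/
def tw (n : ℕ) (a : ZMod 2) (X : Mat n) : Mat n := if a = 1 then par n X else X

lemma bracket_apply (n : ℕ) (X Y : Mat n) : bracket n X Y = X * Y
    - ((2⁻¹ : ℂ) • (Y + par n Y) * X + (2⁻¹ : ℂ) • (Y - par n Y) * par n X) := rfl

lemma bracket_left {n : ℕ} {a : ZMod 2} {X : Mat n} (hX : par n X = koszul a 1 • X) (Y : Mat n) :
    bracket n X Y = X * Y - tw n a Y * X := by
  rw [bracket_apply, hX]
  rcases LieSuperalgebra.zmod_two a with rfl | rfl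
  · rw [show koszul 0 1 = 1 by simp [koszul], one_smul, ← add_mul, ← smul_add,
      show Y + par n Y + (Y - par n Y) = (2 : ℂ) • Y by rw [two_smul]; abel, smul_smul]
    norm_num [tw]
  · rw [show koszul 1 1 = -1 by simp [koszul], neg_one_smul, mul_neg, ← sub_eq_add_neg, ← sub_mul,
      ← smul_sub, show Y + par n Y - (Y - par n Y) = (2 : ℂ) • par n Y by rw [two_smul]; abel,
      smul_smul]
    norm_num [tw]

lemma tw_hom {n : ℕ} (a : ZMod 2) {b : ZMod 2} {Y : Mat n} (hY : par n Y = koszul b 1 • Y) :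
    tw n a Y = koszul a b • Y := by
  rcases LieSuperalgebra.zmod_two a with rfl | rfl
  · simp [tw, koszul]
  · simp [tw, hY, LieSuperalgebra.koszul_symm 1 b]

lemma bracket_hom {n : ℕ} {a b : ZMod 2} {X Y : Mat n} (hX : par n X = koszul a 1 • X)
    (hY : par n Y = koszul b 1 • Y) : bracket n X Y = X * Y - koszul a b • (Y * X) := by
  rw [bracket_left hX, tw_hom a hY, Matrix.smul_mul]

lemma par_bracket (n : ℕ) (X Y : Mat n) :
    par n (bracket n X Y) = bracket n (par n X) (par n Y) := by
  simp only [bracket_apply, map_sub, map_add, map_smul, par_mul]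

lemma str_par_mul (n : ℕ) (X Y : Mat n) : str n (par n Y * X) = str n (X * Y) := by
  rw [str_eq, str_eq, par_apply, mul_assoc, gr_gr_mul, mul_assoc, Matrix.trace_mul_comm, mul_assoc]

lemma str_bracket (n : ℕ) (X Y : Mat n) : str n (bracket n X Y) = 0 := by
  have h1 := str_par_mul n X Y
  have h2 : str n (par n Y * par n X) = str n (Y * X) := by rw [← par_mul, str_par]
  have h3 : str n (Y * par n X) = str n (par n Y * X) := by
    rw [← str_par n (Y * par n X), par_mul, par_par]
  simp only [bracket_apply, map_sub, map_add, map_smul, Matrix.smul_mul, add_mul, sub_mul, h2, h3,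
    h1, smul_eq_mul]
  ring

/-- `sl(n|n)`: the supermatrices of supertrace zero. -/
abbrev SL (n : ℕ) : Submodule ℂ (Mat n) := LinearMap.ker (str n)

/-- The line spanned by the identity matrix in `sl(n|n)`. -/
def center (n : ℕ) : Submodule ℂ (SL n) := (Submodule.span ℂ {(1 : Mat n)}).comap (SL n).subtype

lemma mem_center {n : ℕ} {X : SL n} : X ∈ center n ↔ ∃ c : ℂ, c • (1 : Mat n) = X.1 := by
  rw [center, Submodule.mem_comap, Submodule.mem_span_singleton]; rfl

/-- `psl(n|n)`: the quotient of `sl(n|n)` by the multiples of the identity matrix. -/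
abbrev Psl (n : ℕ) : Type := SL n ⧸ center n

/-- The parity automorphism of `sl(n|n)`. -/
def parSL (n : ℕ) : SL n →ₗ[ℂ] SL n :=
  (par n).restrict fun X hX => by
    rw [LinearMap.mem_ker] at *
    rw [str_par, hX]

/-- The superbracket of `sl(n|n)`. -/
def bracketSL (n : ℕ) : SL n →ₗ[ℂ] SL n →ₗ[ℂ] SL n :=
  LinearMap.mk₂ ℂ (fun X Y => ⟨bracket n X.1 Y.1, str_bracket n X.1 Y.1⟩)
    (fun X X' Y => Subtype.ext (by simp)) (fun c X Y => Subtype.ext (by simp))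
    (fun X Y Y' => Subtype.ext (by simp)) (fun c X Y => Subtype.ext (by simp))

/-- The form `str (X Y)` on `sl(n|n)`. -/
def formSL (n : ℕ) : SL n →ₗ[ℂ] SL n →ₗ[ℂ] ℂ :=
  LinearMap.mk₂ ℂ (fun X Y => str n (X.1 * Y.1))
    (fun X X' Y => by simp [add_mul]) (fun c X Y => by simp)
    (fun X Y Y' => by simp [mul_add]) (fun c X Y => by simp)

/-- Bilinear maps descend to the quotient. -/
def liftQ₂ {M P : Type} [AddCommGroup M] [Module ℂ M] [AddCommGroup P] [Module ℂ P]
    (Z : Submodule ℂ M) (f : M →ₗ[ℂ] M →ₗ[ℂ] P) (h1 : ∀ z ∈ Z, ∀ x, f z x = 0)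
    (h2 : ∀ z ∈ Z, ∀ x, f x z = 0) : M ⧸ Z →ₗ[ℂ] M ⧸ Z →ₗ[ℂ] P :=
  Z.liftQ
    { toFun := fun x => Z.liftQ (f x) (fun z hz => h2 z hz x)
      map_add' := fun x y => Submodule.linearMap_qext _ (LinearMap.ext fun z => by
        change f (x + y) z = f x z + f y z
        rw [map_add, LinearMap.add_apply])
      map_smul' := fun c x => Submodule.linearMap_qext _ (LinearMap.ext fun z => by
        change f (c • x) z = c • f x z
        rw [map_smul, LinearMap.smul_apply]) }
    (fun z hz => Submodule.linearMap_qext _ (LinearMap.ext fun x => h1 z hz x))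

lemma par_smul_one (n : ℕ) (c : ℂ) : par n (c • 1) = c • 1 := by rw [map_smul, par_one]

lemma bracket_one_left (n : ℕ) (c : ℂ) (X : Mat n) : bracket n (c • 1) X = 0 := by
  rw [map_smul, LinearMap.smul_apply, bracket_left (a := 0) (by simp [koszul, par_one])]
  simp [tw]

lemma bracket_one_right (n : ℕ) (c : ℂ) (X : Mat n) : bracket n X (c • 1) = 0 := by
  rw [map_smul, bracket_apply, par_one, ← two_smul ℂ (1 : Mat n), smul_smul]
  simp

/-- The parity automorphism of `psl(n|n)`. -/
def parPsl (n : ℕ) : Psl n →ₗ[ℂ] Psl n :=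
  (center n).mapQ (center n) (parSL n) fun X hX => by
    obtain ⟨c, hc⟩ := mem_center.1 hX
    refine mem_center.2 ⟨c, ?_⟩
    change _ = par n X.1
    rw [← hc, par_smul_one]

/-- The superbracket of `psl(n|n)`. -/
def bracketPsl (n : ℕ) : Psl n →ₗ[ℂ] Psl n →ₗ[ℂ] Psl n :=
  liftQ₂ (center n) ((bracketSL n).compr₂ (center n).mkQ)
    (fun z hz x => by
      obtain ⟨c, hc⟩ := mem_center.1 hz
      have : bracketSL n z x = 0 := Subtype.ext (by
        change bracket n z.1 x.1 = 0
        rw [← hc, bracket_one_left])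
      rw [LinearMap.compr₂_apply, this, map_zero])
    (fun z hz x => by
      obtain ⟨c, hc⟩ := mem_center.1 hz
      have : bracketSL n x z = 0 := Subtype.ext (by
        change bracket n x.1 z.1 = 0
        rw [← hc, bracket_one_right])
      rw [LinearMap.compr₂_apply, this, map_zero])

/-- The invariant form `str (X Y)` of `psl(n|n)`. -/
def formPsl (n : ℕ) : Psl n →ₗ[ℂ] Psl n →ₗ[ℂ] ℂ :=
  liftQ₂ (center n) (formSL n)
    (fun z hz x => by
      obtain ⟨c, hc⟩ := mem_center.1 hz
      change str n (z.1 * x.1) = 0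
      rw [← hc, Matrix.smul_mul, one_mul, map_smul, x.2, smul_zero])
    (fun z hz x => by
      obtain ⟨c, hc⟩ := mem_center.1 hz
      change str n (x.1 * z.1) = 0
      rw [← hc, Matrix.mul_smul, mul_one, map_smul, x.2, smul_zero])

/-- The class in `psl(n|n)` of a matrix in `sl(n|n)`. -/
abbrev cls {n : ℕ} (X : SL n) : Psl n := (center n).mkQ X

lemma parPsl_cls {n : ℕ} (X : SL n) : parPsl n (cls X) = cls (parSL n X) := rfl

lemma bracketPsl_cls {n : ℕ} (X Y : SL n) :
    bracketPsl n (cls X) (cls Y) = cls (bracketSL n X Y) := rfl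

lemma formPsl_cls {n : ℕ} (X Y : SL n) : formPsl n (cls X) (cls Y) = str n (X.1 * Y.1) := rfl

lemma exists_hom {n : ℕ} {a : ZMod 2} {x : Psl n} (hx : parPsl n x = koszul a 1 • x) :
    ∃ X : SL n, cls X = x ∧ par n X.1 = koszul a 1 • X.1 := by
  obtain ⟨X, rfl⟩ := (center n).mkQ_surjective x
  have hk := LieSuperalgebra.koszul_mul_self a 1
  refine ⟨(2⁻¹ : ℂ) • (X + koszul a 1 • parSL n X), ?_, ?_⟩
  · change (2⁻¹ : ℂ) • (cls X + koszul a 1 • parPsl n (cls X)) = _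
    rw [hx, smul_smul, hk, one_smul, ← two_smul ℂ, smul_smul]
    norm_num
  · change par n ((2⁻¹ : ℂ) • (X.1 + koszul a 1 • par n X.1)) =
      koszul a 1 • ((2⁻¹ : ℂ) • (X.1 + koszul a 1 • par n X.1))
    rw [map_smul, map_add, map_smul, par_par, smul_comm (koszul a 1) (2⁻¹ : ℂ),
      smul_add (koszul a 1), smul_smul (koszul a 1), hk, one_smul, add_comm]

lemma tw_mul (n : ℕ) (a : ZMod 2) (X Y : Mat n) : tw n a (X * Y) = tw n a X * tw n a Y := by
  unfold tw; split_ifs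
  · exact par_mul n X Y
  · rfl

lemma tw_sub (n : ℕ) (a : ZMod 2) (X Y : Mat n) : tw n a (X - Y) = tw n a X - tw n a Y := by
  unfold tw; split_ifs
  · exact map_sub _ X Y
  · rfl

lemma tw_tw (n : ℕ) (a b : ZMod 2) (X : Mat n) : tw n a (tw n b X) = tw n (a + b) X := by
  rcases LieSuperalgebra.zmod_two a with rfl | rfl <;>
    rcases LieSuperalgebra.zmod_two b with rfl | rfl
  · rfl
  · simp [tw]
  · simp [tw]
  · exact par_par n X

lemma par_bracket_hom {n : ℕ} {a b : ZMod 2} {X Y : Mat n} (hX : par n X = koszul a 1 • X)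
    (hY : par n Y = koszul b 1 • Y) : par n (bracket n X Y) = koszul (a + b) 1 • bracket n X Y := by
  rw [par_bracket, hX, hY, LieSuperalgebra.koszul_add, map_smul, map_smul, LinearMap.smul_apply,
    smul_smul, mul_comm]

lemma bracket_jacobi {n : ℕ} {a b : ZMod 2} {X Y : Mat n} (hX : par n X = koszul a 1 • X)
    (hY : par n Y = koszul b 1 • Y) (Z : Mat n) :
    bracket n X (bracket n Y Z) =
      bracket n (bracket n X Y) Z + koszul a b • bracket n Y (bracket n X Z) := by
  rw [bracket_left (par_bracket_hom hX hY), bracket_left hX, bracket_left hY, bracket_left hY,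
    bracket_left hX, bracket_left hX, tw_sub, tw_sub, tw_mul, tw_mul, tw_mul, tw_mul, tw_tw,
    tw_tw, tw_hom a hY, tw_hom b hX, add_comm b a, LieSuperalgebra.koszul_symm b a]
  rcases (show koszul a b = 1 ∨ koszul a b = -1 by unfold koszul; split_ifs <;> simp) with h | h <;>
    rw [h] <;> simp only [one_smul, neg_smul] <;> noncomm_ring

lemma form_symm_hom {n : ℕ} {a b : ZMod 2} {X Y : Mat n} (hX : par n X = koszul a 1 • X)
    (hY : par n Y = koszul b 1 • Y) : str n (X * Y) = koszul a b • str n (Y * X) := by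
  have h1 := str_par_mul n X Y
  rw [hY, Matrix.smul_mul, map_smul] at h1
  have h2 := str_par n (Y * X)
  rw [par_mul, hX, hY, Matrix.smul_mul, Matrix.mul_smul, map_smul, map_smul, smul_smul] at h2
  rw [← h1]
  rcases LieSuperalgebra.zmod_two a with rfl | rfl <;>
    rcases LieSuperalgebra.zmod_two b with rfl | rfl
  · simp [koszul]
  · simp only [koszul, smul_eq_mul] at *; norm_num at *; linear_combination h2
  · simp only [koszul, smul_eq_mul] at *; norm_num at *
  · simp [koszul]

lemma form_invariant_hom {n : ℕ} {a b : ZMod 2} {X Y : Mat n} (hX : par n X = koszul a 1 • X)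
    (hY : par n Y = koszul b 1 • Y) (Z : Mat n) :
    str n (bracket n X Y * Z) = str n (X * bracket n Y Z) := by
  rw [bracket_hom hX hY, bracket_left hY, sub_mul, mul_sub, map_sub, map_sub, mul_assoc]
  congr 1
  rcases LieSuperalgebra.zmod_two b with rfl | rfl
  · have h := str_par_mul n (X * Z) Y
    rw [hY] at h
    simp only [koszul, tw] at *
    norm_num at *
    rw [← mul_assoc X, ← h, mul_assoc]
  · have h := str_par_mul n (par n X * Z) (par n Y)
    rw [par_par, show par n X * Z * par n Y = par n (X * (par n Z * Y)) by
      rw [par_mul, par_mul, par_par, mul_assoc], str_par] at h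
    rw [show tw n 1 Z = par n Z by simp [tw], ← h, ← Matrix.mul_smul, ← hX, mul_assoc]

/-- The Lie superalgebra `psl(n|n)` with the invariant form `str (X Y)`. -/
def psl (n : ℕ) : LieSuperalgebra (Psl n) where
  par := parPsl n
  par_par x := by
    obtain ⟨X, rfl⟩ := (center n).mkQ_surjective x
    exact congrArg cls (Subtype.ext (par_par n X.1))
  bracket := bracketPsl n
  form := formPsl n
  par_bracket x y := by
    obtain ⟨X, rfl⟩ := (center n).mkQ_surjective x
    obtain ⟨Y, rfl⟩ := (center n).mkQ_surjective y
    exact congrArg cls (Subtype.ext (par_bracket n X.1 Y.1))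
  form_par x y := by
    obtain ⟨X, rfl⟩ := (center n).mkQ_surjective x
    obtain ⟨Y, rfl⟩ := (center n).mkQ_surjective y
    change str n (par n X.1 * par n Y.1) = str n (X.1 * Y.1)
    rw [← par_mul, str_par]
  bracket_skew a b x y hx hy := by
    obtain ⟨X, rfl, hX⟩ := exists_hom hx
    obtain ⟨Y, rfl, hY⟩ := exists_hom hy
    refine congrArg cls (Subtype.ext (?_ : bracket n X.1 Y.1 = -(koszul a b • bracket n Y.1 X.1)))
    rw [bracket_hom hX hY, bracket_hom hY hX, LieSuperalgebra.koszul_symm b a, smul_sub, smul_smul,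
      LieSuperalgebra.koszul_mul_self, one_smul, neg_sub]
  jacobi a b x y z hx hy := by
    obtain ⟨X, rfl, hX⟩ := exists_hom hx
    obtain ⟨Y, rfl, hY⟩ := exists_hom hy
    obtain ⟨Z, rfl⟩ := (center n).mkQ_surjective z
    exact congrArg cls (Subtype.ext (bracket_jacobi hX hY Z.1))
  form_symm a b x y hx hy := by
    obtain ⟨X, rfl, hX⟩ := exists_hom hx
    obtain ⟨Y, rfl, hY⟩ := exists_hom hy
    exact form_symm_hom hX hY
  form_invariant a b x y z hx hy := by
    obtain ⟨X, rfl, hX⟩ := exists_hom hx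
    obtain ⟨Y, rfl, hY⟩ := exists_hom hy
    obtain ⟨Z, rfl⟩ := (center n).mkQ_surjective z
    exact form_invariant_hom hX hY Z.1

/-- The odd elementary matrix `E^(i, n+j)` as an element of `psl(n|n)`. -/
def oddE {n : ℕ} (i j : Fin n) : Psl n :=
  cls ⟨Matrix.single (Sum.inl i) (Sum.inr j) 1, by
    simp [str, Matrix.toBlocks₁₁, Matrix.toBlocks₂₂, Matrix.trace]⟩

/-- The vector `χ = E^(1,2n-1)_(-1) E^(1,2n)_(-1) |0>` of `V^1(psl(n|n))`. -/
def chi (n : ℕ) (hn : 2 ≤ n) : (psl n).Vac 1 :=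
  (psl n).mode 1 (oddE ⟨0, by omega⟩ ⟨n - 2, by omega⟩) (-1)
    ((psl n).mode 1 (oddE ⟨0, by omega⟩ ⟨n - 1, by omega⟩) (-1) ((psl n).vac 1))

/-- The minimal nilpotent orbit of `sl_n`: the traceless matrices of rank one. -/
def minOrbit (n : ℕ) : Set (LieAlgebra.SpecialLinear.sl (Fin n) ℂ) := {Z | Z.1.rank = 1}

/-- The embedding of `sl_n` in the dual of `psl(n|n)`: the matrix `Z` gives the functional
`X ↦ 1/(2n) * trace (X₂₂ * Z)`, where `X₂₂` is the lower right block of `X`. -/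
def slToDual (n : ℕ) (Z : LieAlgebra.SpecialLinear.sl (Fin n) ℂ) : Module.Dual ℂ (Psl n) :=
  (center n).liftQ
    { toFun := fun X => (1 / (2 * n) : ℂ) * (X.1.toBlocks₂₂ * Z.1).trace
      map_add' := fun X Y => by
        rw [← mul_add, ← Matrix.trace_add, ← add_mul]; rfl
      map_smul' := fun c X => by
        rw [RingHom.id_apply, smul_eq_mul, mul_left_comm, ← smul_eq_mul c, ← Matrix.trace_smul,
          ← Matrix.smul_mul]; rfl }
    (fun X hX => by
      obtain ⟨c, hc⟩ := mem_center.1 hX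
      have hZ : Z.1.trace = 0 := Z.2
      have h : X.1.toBlocks₂₂ = c • 1 := by
        rw [← hc]
        ext i j
        simp [Matrix.toBlocks₂₂, Matrix.one_apply]
      rw [LinearMap.mem_ker]
      change (1 / (2 * n) : ℂ) * (X.1.toBlocks₂₂ * Z.1).trace = 0
      rw [h, Matrix.smul_mul, one_mul, Matrix.trace_smul, hZ, smul_zero, mul_zero])

end PSL

end

noncomputable section

/-! ### Zero modes on quadratic vectors, and what a character sees of them. -/

namespace Affine.LieSuperalgebra

variable {g : Type} [AddCommGroup g] [Module ℂ g] {S : LieSuperalgebra g} {k : ℂ}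

/-! A character kills odd elements, so it cannot see χ, a product of two odd elements. Applying two
odd zero modes to χ gives a vector of `U` whose leading part is a product of two even elements, and
this gives a quadratic equation on the functional `l`. The point is to obtain enough such equations.

Write an element of the upper right odd block as a matrix; rank one ones are `v fᵀ`. Then χ is the
product of `v fᵀ` and `v f'ᵀ` for special `v`, `f`, `f'`. The zero modes of the even part act
through left and right multiplication by all matrices, up to scalars, and move χ to the product of
`v fᵀ` and `v f'ᵀ` for arbitrary `v`, `f`, `f'` (`upperQuad_columns`, `upperQuad_rows`).

Now apply the zero modes of `w ξᵀ` and `w' ξᵀ` in the lower left block. Since `(v fᵀ)(w ξᵀ) = (f·w)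
v ξᵀ` and `(w ξᵀ)(v fᵀ) = (ξ·v) w fᵀ`, the result is a vanishing 2 × 2 determinant with entries
mixing both diagonal blocks (`apply_bracket_mul`, `character_relation`). If `ξ·v = 0`, only the
upper left block remains, and a suitable choice gives `l(v ξᵀ)² = 0`; rank one nilpotents and the
identity span all matrices, so `l` vanishes on the upper left block (`character_leftBlock`). If `ξ·v
= 1`, what is left says that the 2 × 2 minors of `l` on the lower right block vanish
(`character_rightBlock`). Hence `l` is given by a traceless matrix of rank at most one, and such
matrices form the closure of the minimal orbit. -/

lemma mem_generated (v : S.Vac k) : v ∈ S.generated k v :=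
  Submodule.mem_sInf.2 fun _ hW => hW.1

lemma mode_mem_generated {v w : S.Vac k} (x : g) (m : ℤ) (hw : w ∈ S.generated k v) :
    S.mode k x m w ∈ S.generated k v :=
  Submodule.mem_sInf.2 fun W hW => hW.2.1 x m w (Submodule.mem_sInf.1 hw W hW)

variable (S k) in
/-- The vector `y_(-1) z_(-1) |0>`. -/
def quad (y z : g) : S.Vac k := S.mode k y (-1) (S.mode k z (-1) (S.vac k))

lemma quad_add_left (y y' z : g) : S.quad k (y + y') z = S.quad k y z + S.quad k y' z := by
  simp [quad, mode_add]

lemma quad_smul_left (c : ℂ) (y z : g) : S.quad k (c • y) z = c • S.quad k y z := by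
  simp [quad, mode_smul]

lemma quad_add_right (y z z' : g) : S.quad k y (z + z') = S.quad k y z + S.quad k y z' := by
  simp [quad, mode_add]

lemma quad_smul_right (c : ℂ) (y z : g) : S.quad k y (c • z) = c • S.quad k y z := by
  simp [quad, mode_smul]

/-- A zero mode is a superderivation for the (-1)-modes: the commutator of `x_(0)` and `y_(-1)` is
`[x, y]_(-1)`, without a central term because `0 + (-1) ≠ 0`, and `x_(0)` kills the vacuum. -/
lemma mode_zero_quad {a b c : ZMod 2} {x y z : g} (hx : x ∈ S.gr a) (hy : y ∈ S.gr b)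
    (hz : z ∈ S.gr c) : S.mode k x 0 (S.quad k y z) =
      S.quad k (S.bracket x y) z + koszul a b • S.quad k y (S.bracket x z) := by
  unfold quad
  rw [mode_comm hx hy, mode_comm hx hz, mode_vac x 0 le_rfl]
  simp [add_comm]

variable {U : Submodule ℂ (S.Vac k)}

lemma toZhu_of_mem {v : S.Vac k} (hv : v ∈ U) : S.toZhu U v = 0 := by
  have h : U.mkQ v = 0 := (Submodule.Quotient.mk_eq_zero U).2 hv
  rw [toZhu, LinearMap.comp_apply, h, map_zero]

lemma toZhu_mode (x : g) {m : ℤ} (hm : m ≤ -2) (v : S.Vac k) :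
    S.toZhu U (S.mode k x m v) = 0 := by
  refine (Submodule.Quotient.mk_eq_zero (S.C2 U)).2 (Submodule.subset_span ⟨x, -m, v, ?_, ?_⟩)
  · omega
  · rw [neg_neg]

namespace IsCharacter

variable {φ : S.Zhu U →ₗ[ℂ] ℂ} {l : Module.Dual ℂ g}

/-- The (-1)-mode of the state `x_(-1)|0⟩` is `x_(-1)` itself, so multiplicativity of the character
applies. -/
lemma map_mode (hφ : S.IsCharacter U φ)
    (hl : ∀ x, l x = φ (S.toZhu U (S.mode k x (-1) (S.vac k)))) (x : g) (v : S.Vac k) :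
    φ (S.toZhu U (S.mode k x (-1) v)) = l x * φ (S.toZhu U v) := by
  rw [hl, ← hφ.map_mul, Y_generator]

lemma map_quad (hφ : S.IsCharacter U φ)
    (hl : ∀ x, l x = φ (S.toZhu U (S.mode k x (-1) (S.vac k)))) (y z : g) :
    φ (S.toZhu U (S.quad k y z)) = l y * l z := by
  rw [quad, hφ.map_mode hl, ← hl]

/-- The functional of a character vanishes on odd elements. -/
lemma apply_odd (hφ : S.IsCharacter U φ)
    (hl : ∀ x, l x = φ (S.toZhu U (S.mode k x (-1) (S.vac k)))) {x : g} (hx : x ∈ S.gr 1) :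
    l x = 0 := by
  -- An odd `x_(-1)` anticommutes with itself up to `[x, x]_(-2)`, which lands in `C_2`. Hence `2
  -- l(x)² = 0`.
  have h := congrArg (fun v => φ (S.toZhu U v)) (mode_comm (k := k) hx hx (-1) (-1) (S.vac k))
  simp only [map_add, map_smul, toZhu_mode (U := U) (S.bracket x x) (m := -1 + -1) (by norm_num)]
    at h
  have h2 := hφ.map_quad hl x x
  unfold quad at h2
  rw [h2] at h
  norm_num [koszul] at h
  have h3 : l x * l x = 0 := by linear_combination h / 2
  exact mul_self_eq_zero.1 h3

/-- The relation obtained from an element `y_(-1) z_(-1) |0>` with `y`, `z` odd by applying two odd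
zero modes. -/
lemma apply_bracket_mul (hφ : S.IsCharacter U φ)
    (hl : ∀ x, l x = φ (S.toZhu U (S.mode k x (-1) (S.vac k))))
    (hU : ∀ x m, ∀ v ∈ U, S.mode k x m v ∈ U) {x x' y z : g} (hx : x ∈ S.gr 1)
    (hx' : x' ∈ S.gr 1) (hy : y ∈ S.gr 1) (hz : z ∈ S.gr 1) (h : S.quad k y z ∈ U) :
    l (S.bracket x' y) * l (S.bracket x z) = l (S.bracket x y) * l (S.bracket x' z) := by
  -- Of the four terms of `x_(0) x'_(0) y_(-1) z_(-1)|0⟩`, the two in which both modes hit the same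
  -- factor keep an odd `y` or `z` and are killed. The other two carry opposite signs, since `x`
  -- passes the even `[x', y]` freely and `x'` passes the odd `y` with a sign.
  have h1 := hU x 0 _ (hU x' 0 _ h)
  rw [mode_zero_quad hx' hy hz, map_add, map_smul, mode_zero_quad hx (bracket_mem hx' hy) hz,
    mode_zero_quad hx hy (bracket_mem hx' hz)] at h1
  have h2 := congrArg φ (toZhu_of_mem h1)
  simp only [map_add, map_smul, hφ.map_quad hl, hφ.apply_odd hl hy, hφ.apply_odd hl hz,
    map_zero] at h2
  simp [koszul, show (1 : ZMod 2) + 1 = 0 from rfl] at h2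
  linear_combination h2

end IsCharacter

end Affine.LieSuperalgebra

/-! ### The blocks of psl(n|n) and their brackets. -/

namespace PSL

open Affine LieSuperalgebra Matrix

variable {n : ℕ}

/-- The even element of `psl(n|n)` with diagonal blocks `A` and `D`. -/
def diagBlocks (A D : Matrix (Fin n) (Fin n) ℂ) (h : A.trace = D.trace) : Psl n :=
  cls ⟨fromBlocks A 0 0 D, by simp [str, h]⟩

/-- The odd element of `psl(n|n)` with upper right block `B`. -/
def upperBlock (B : Matrix (Fin n) (Fin n) ℂ) : Psl n :=
  cls ⟨fromBlocks 0 B 0 0, by simp [str]⟩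

/-- The odd element of `psl(n|n)` with lower left block `C`. -/
def lowerBlock (C : Matrix (Fin n) (Fin n) ℂ) : Psl n :=
  cls ⟨fromBlocks 0 0 C 0, by simp [str]⟩

lemma par_fromBlocks (A B C D : Matrix (Fin n) (Fin n) ℂ) :
    par n (fromBlocks A B C D) = fromBlocks A (-B) (-C) D := by
  simp [par_apply, gr, fromBlocks_multiply]

lemma par_diag (A D : Matrix (Fin n) (Fin n) ℂ) :
    par n (fromBlocks A 0 0 D) = koszul 0 1 • fromBlocks A 0 0 D := by
  simp [par_fromBlocks, koszul]

lemma par_upper (B : Matrix (Fin n) (Fin n) ℂ) :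
    par n (fromBlocks 0 B 0 0) = koszul 1 1 • fromBlocks 0 B 0 0 := by
  simp [par_fromBlocks, koszul, fromBlocks_neg]

lemma par_lower (C : Matrix (Fin n) (Fin n) ℂ) :
    par n (fromBlocks 0 0 C 0) = koszul 1 1 • fromBlocks 0 0 C 0 := by
  simp [par_fromBlocks, koszul, fromBlocks_neg]

lemma diagBlocks_mem (A D : Matrix (Fin n) (Fin n) ℂ) (h : A.trace = D.trace) :
    diagBlocks A D h ∈ (psl n).gr 0 := congrArg cls (Subtype.ext (par_diag A D))

lemma upperBlock_mem (B : Matrix (Fin n) (Fin n) ℂ) : upperBlock B ∈ (psl n).gr 1 :=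
  congrArg cls (Subtype.ext (par_upper B))

lemma lowerBlock_mem (C : Matrix (Fin n) (Fin n) ℂ) : lowerBlock C ∈ (psl n).gr 1 :=
  congrArg cls (Subtype.ext (par_lower C))

lemma bracket_diagBlocks_upperBlock (A D B : Matrix (Fin n) (Fin n) ℂ) (h : A.trace = D.trace) :
    (psl n).bracket (diagBlocks A D h) (upperBlock B) = upperBlock (A * B - B * D) := by
  refine congrArg cls (Subtype.ext ?_)
  change bracket n (fromBlocks A 0 0 D) (fromBlocks 0 B 0 0) = fromBlocks 0 (A * B - B * D) 0 0
  rw [bracket_hom (par_diag A D) (par_upper B)]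
  simp [koszul, fromBlocks_multiply, sub_eq_add_neg, fromBlocks_neg, fromBlocks_add]

lemma bracket_lowerBlock_upperBlock (C B : Matrix (Fin n) (Fin n) ℂ) :
    (psl n).bracket (lowerBlock C) (upperBlock B) =
      diagBlocks (B * C) (C * B) (trace_mul_comm B C) := by
  refine congrArg cls (Subtype.ext ?_)
  change bracket n (fromBlocks 0 0 C 0) (fromBlocks 0 B 0 0) = fromBlocks (B * C) 0 0 (C * B)
  rw [bracket_hom (par_lower C) (par_upper B)]
  simp [koszul, fromBlocks_multiply, fromBlocks_add]

lemma upperBlock_add (B B' : Matrix (Fin n) (Fin n) ℂ) :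
    upperBlock (B + B') = upperBlock B + upperBlock B' :=
  congrArg cls (Subtype.ext (by simp [fromBlocks_add]))

lemma upperBlock_smul (c : ℂ) (B : Matrix (Fin n) (Fin n) ℂ) :
    upperBlock (c • B) = c • upperBlock B :=
  congrArg cls (Subtype.ext (by simp [fromBlocks_smul]))

/-! ### Quadratic vectors in the upper right block, and spreading χ by even zero modes. -/

variable {U : Submodule ℂ ((psl n).Vac 1)}

variable (n) in
/-- The vector `y_(-1) z_(-1) |0>` for `y`, `z` in the upper right block. -/
def upperQuad (B B' : Matrix (Fin n) (Fin n) ℂ) : (psl n).Vac 1 :=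
  (psl n).quad 1 (upperBlock B) (upperBlock B')

lemma upperQuad_add_left (B B' C : Matrix (Fin n) (Fin n) ℂ) :
    upperQuad n (B + B') C = upperQuad n B C + upperQuad n B' C := by
  simp [upperQuad, upperBlock_add, quad_add_left]

lemma upperQuad_add_right (B C C' : Matrix (Fin n) (Fin n) ℂ) :
    upperQuad n B (C + C') = upperQuad n B C + upperQuad n B C' := by
  simp [upperQuad, upperBlock_add, quad_add_right]

lemma upperQuad_smul_left (c : ℂ) (B C : Matrix (Fin n) (Fin n) ℂ) :
    upperQuad n (c • B) C = c • upperQuad n B C := by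
  simp [upperQuad, upperBlock_smul, quad_smul_left]

lemma upperQuad_smul_right (c : ℂ) (B C : Matrix (Fin n) (Fin n) ℂ) :
    upperQuad n B (c • C) = c • upperQuad n B C := by
  simp [upperQuad, upperBlock_smul, quad_smul_right]

lemma mode_diagBlocks_upperQuad (A D B B' : Matrix (Fin n) (Fin n) ℂ) (h : A.trace = D.trace) :
    (psl n).mode 1 (diagBlocks A D h) 0 (upperQuad n B B') =
      upperQuad n (A * B - B * D) B' + upperQuad n B (A * B' - B' * D) := by
  unfold upperQuad
  rw [mode_zero_quad (diagBlocks_mem A D h) (upperBlock_mem B) (upperBlock_mem B'),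
    bracket_diagBlocks_upperBlock, bracket_diagBlocks_upperBlock]
  simp [koszul]

/-- Supertrace zero forces equal traces of the diagonal blocks; a scalar block with the right trace
completes an arbitrary `A`, so all of `gl_n` is available on either side. -/
lemma trace_scalar (hn : n ≠ 0) (A : Matrix (Fin n) (Fin n) ℂ) :
    ((A.trace / n) • (1 : Matrix (Fin n) (Fin n) ℂ)).trace = A.trace := by
  rw [trace_smul, trace_one, Fintype.card_fin, smul_eq_mul,
    div_mul_cancel₀ _ (Nat.cast_ne_zero.2 hn)]

/-- Left multiplication by `A`, acting as a derivation on `upperQuad`, is a zero mode up to a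
scalar. -/
lemma mode_left (hn : n ≠ 0) (A B B' : Matrix (Fin n) (Fin n) ℂ) :
    upperQuad n (A * B) B' + upperQuad n B (A * B') =
      (psl n).mode 1 (diagBlocks A ((A.trace / n) • 1) (trace_scalar hn A).symm) 0
        (upperQuad n B B') + (2 * (A.trace / n)) • upperQuad n B B' := by
  -- With `t = tr A / n`, the completing block sends `B` to `-t B` in each of the two factors;
  -- adding `2t` compensates.
  rw [mode_diagBlocks_upperQuad, Matrix.mul_smul, Matrix.mul_smul, mul_one, mul_one,
    sub_eq_add_neg, sub_eq_add_neg, ← neg_smul, ← neg_smul, upperQuad_add_left,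
    upperQuad_add_right, upperQuad_smul_left, upperQuad_smul_right]
  module

/-- Right multiplication by `D`, acting as a derivation on `upperQuad`, is a zero mode up to a
scalar. -/
lemma mode_right (hn : n ≠ 0) (D B B' : Matrix (Fin n) (Fin n) ℂ) :
    upperQuad n (B * D) B' + upperQuad n B (B' * D) =
      (-1 : ℂ) • (psl n).mode 1 (diagBlocks ((D.trace / n) • 1) D (trace_scalar hn D)) 0
        (upperQuad n B B') + (2 * (D.trace / n)) • upperQuad n B B' := by
  -- Right multiplication enters the bracket as `-B D`, which accounts for the factor `-1`.
  rw [mode_diagBlocks_upperQuad, Matrix.smul_mul, Matrix.smul_mul, one_mul, one_mul,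
    sub_eq_add_neg, sub_eq_add_neg, ← neg_one_smul ℂ (B * D), ← neg_one_smul ℂ (B' * D),
    upperQuad_add_left, upperQuad_add_right, upperQuad_smul_left, upperQuad_smul_right,
    upperQuad_smul_left, upperQuad_smul_right]
  module

/-- Right multiplication by `e_c fᵀ` moves the row `e_c` to `f` and kills `e_d`, so the first row
can be replaced freely. Then `e_d f'ᵀ` moves the second row to `f'`, with an error term already
known to lie in `U`. -/
lemma upperQuad_columns (hn : n ≠ 0) (hU : ∀ x m, ∀ v ∈ U, (psl n).mode 1 x m v ∈ U)
    {v : Fin n → ℂ} {c d : Fin n} (hcd : c ≠ d)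
    (h : upperQuad n (vecMulVec v (Pi.single c 1)) (vecMulVec v (Pi.single d 1)) ∈ U)
    (f f' : Fin n → ℂ) : upperQuad n (vecMulVec v f) (vecMulVec v f') ∈ U := by
  have h1 (f : Fin n → ℂ) : upperQuad n (vecMulVec v f) (vecMulVec v (Pi.single d 1)) ∈ U := by
    have h2 := mode_right hn (vecMulVec (Pi.single c 1) f) (vecMulVec v (Pi.single c 1))
      (vecMulVec v (Pi.single d 1))
    rw [vecMulVec_mul_vecMulVec, vecMulVec_mul_vecMulVec] at h2
    simp only [single_dotProduct, Pi.single_eq_same, Pi.single_eq_of_ne hcd.symm, one_mul, one_smul,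
      zero_smul] at h2
    -- The second factor has become the outer product with the zero row; writing that row as `0 • f`
    -- lets bilinearity remove the term.
    rw [← zero_smul ℂ f, vecMulVec_smul, upperQuad_smul_right, zero_smul, add_zero] at h2
    rw [h2]
    exact U.add_mem (U.smul_mem _ (hU _ _ _ h)) (U.smul_mem _ h)
  have h2 := mode_right hn (vecMulVec (Pi.single d 1) f') (vecMulVec v f)
    (vecMulVec v (Pi.single d 1))
  rw [vecMulVec_mul_vecMulVec, vecMulVec_mul_vecMulVec] at h2
  simp only [dotProduct_single, Pi.single_eq_same, mul_one, one_smul, vecMulVec_smul,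
    upperQuad_smul_left] at h2
  -- The error term is the product with first row `f'` and second row `e_d`, scaled by `f d`: an
  -- instance of `h1`.
  rw [← eq_sub_iff_add_eq'] at h2
  rw [h2]
  exact U.sub_mem (U.add_mem (U.smul_mem _ (hU _ _ _ (h1 f))) (U.smul_mem _ (h1 f)))
    (U.smul_mem _ (h1 f'))

/-- Both factors must change their column from `e_i` to `v` together. Let `δ` be the derivation
given by left multiplication by `v e_iᵀ`, which sends `e_i` to `v` and `v` to `v_i v`. If `Q` is the
given vector, `P = δ Q` has one column replaced in each term, and `δ P = 2 R + v_i P` with `R` the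
wanted vector; so `R = (δ P - v_i P) / 2`. -/
lemma upperQuad_rows (hn : n ≠ 0) (hU : ∀ x m, ∀ v ∈ U, (psl n).mode 1 x m v ∈ U)
    {i : Fin n} {f f' : Fin n → ℂ}
    (h : upperQuad n (vecMulVec (Pi.single i 1) f) (vecMulVec (Pi.single i 1) f') ∈ U)
    (v : Fin n → ℂ) : upperQuad n (vecMulVec v f) (vecMulVec v f') ∈ U := by
  have e1 (f : Fin n → ℂ) : vecMulVec v (Pi.single i 1) * vecMulVec (Pi.single i 1) f =
      vecMulVec v f := by simp [vecMulVec_mul_vecMulVec]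
  have e2 (f : Fin n → ℂ) : vecMulVec v (Pi.single i 1) * vecMulVec v f =
      v i • vecMulVec v f := by simp [vecMulVec_mul_vecMulVec, vecMulVec_smul]
  have h1 := mode_left hn (vecMulVec v (Pi.single i 1)) (vecMulVec (Pi.single i 1) f)
    (vecMulVec (Pi.single i 1) f')
  rw [e1, e1] at h1
  -- This is `P = δ Q`.
  have h2 : upperQuad n (vecMulVec v f) (vecMulVec (Pi.single i 1) f') +
      upperQuad n (vecMulVec (Pi.single i 1) f) (vecMulVec v f') ∈ U := by
    rw [h1]
    exact U.add_mem (hU _ _ _ h) (U.smul_mem _ h)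
  have h3 := mode_left hn (vecMulVec v (Pi.single i 1)) (vecMulVec v f)
    (vecMulVec (Pi.single i 1) f')
  have h4 := mode_left hn (vecMulVec v (Pi.single i 1)) (vecMulVec (Pi.single i 1) f)
    (vecMulVec v f')
  rw [e1, e2, upperQuad_smul_left] at h3
  rw [e1, e2, upperQuad_smul_right] at h4
  -- This is `δ P`, written as a zero mode plus the scalar correction of `mode_left`.
  have h5 := U.add_mem (hU (diagBlocks (vecMulVec v (Pi.single i 1)) _
    (trace_scalar hn _).symm) 0 _ h2)
    (U.smul_mem (2 * ((vecMulVec v (Pi.single i 1)).trace / n)) h2)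
  rw [map_add] at h5
  have h6 := U.smul_mem (2⁻¹ : ℂ) (U.sub_mem h5 (U.smul_mem (v i) h2))
  have e3 : upperQuad n (vecMulVec v f) (vecMulVec v f') =
      (2⁻¹ : ℂ) • ((v i • upperQuad n (vecMulVec v f) (vecMulVec (Pi.single i 1) f') +
          upperQuad n (vecMulVec v f) (vecMulVec v f')) +
        (upperQuad n (vecMulVec v f) (vecMulVec v f') +
          v i • upperQuad n (vecMulVec (Pi.single i 1) f) (vecMulVec v f')) -
        v i • (upperQuad n (vecMulVec v f) (vecMulVec (Pi.single i 1) f') +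
          upperQuad n (vecMulVec (Pi.single i 1) f) (vecMulVec v f'))) := by module
  rw [e3, h3, h4]
  convert h6 using 2
  module

lemma vecMulVec_single_single (i j : Fin n) :
    vecMulVec (Pi.single i 1) (Pi.single j 1) = single i j (1 : ℂ) :=
  (single_eq_single_vecMulVec_single i j).symm

lemma upperBlock_vecMulVec_single (i j : Fin n) :
    upperBlock (vecMulVec (Pi.single i 1) (Pi.single j 1)) = oddE i j := by
  refine congrArg cls (Subtype.ext ?_)
  change fromBlocks 0 (vecMulVec (Pi.single i 1) (Pi.single j 1)) 0 0 =
    single (Sum.inl i) (Sum.inr j) 1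
  rw [vecMulVec_single_single]
  ext (a | a) (b | b) <;> simp [single_apply]

/-- χ is the case where `v` is the first basis vector and `f`, `f'` are the last two; these last two
are distinct because `n ≥ 2`. -/
lemma upperQuad_mem_generated_chi (hn : 2 ≤ n) (v f f' : Fin n → ℂ) :
    upperQuad n (vecMulVec v f) (vecMulVec v f') ∈ (psl n).generated 1 (chi n hn) := by
  have hU := fun x m v (hv : v ∈ (psl n).generated 1 (chi n hn)) => mode_mem_generated x m hv
  have hcd : (⟨n - 2, by omega⟩ : Fin n) ≠ ⟨n - 1, by omega⟩ := by
    rw [Ne, Fin.mk.injEq]; omega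
  refine upperQuad_rows (i := ⟨0, by omega⟩) (by omega) hU
    (upperQuad_columns (by omega) hU hcd ?_ f f') v
  rw [upperQuad, upperBlock_vecMulVec_single, upperBlock_vecMulVec_single]
  exact mem_generated _

/-! ### Splitting the even part into two copies of matrices modulo scalars. -/

lemma diagBlocks_congr {A D A' D' : Matrix (Fin n) (Fin n) ℂ} (h : A.trace = D.trace)
    (h' : A'.trace = D'.trace) (hA : A = A') (hD : D = D') :
    diagBlocks A D h = diagBlocks A' D' h' := by
  subst hA hD; rfl

lemma diagBlocks_add {A D A' D' : Matrix (Fin n) (Fin n) ℂ} (h : A.trace = D.trace)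
    (h' : A'.trace = D'.trace) (h'' : (A + A').trace = (D + D').trace) :
    diagBlocks (A + A') (D + D') h'' = diagBlocks A D h + diagBlocks A' D' h' :=
  congrArg cls (Subtype.ext (by simp [fromBlocks_add]))

lemma diagBlocks_smul {A D : Matrix (Fin n) (Fin n) ℂ} (c : ℂ) (h : A.trace = D.trace)
    (h' : (c • A).trace = (c • D).trace) :
    diagBlocks (c • A) (c • D) h' = c • diagBlocks A D h :=
  congrArg cls (Subtype.ext (by simp [fromBlocks_smul]))

lemma diagBlocks_scalar (c : ℂ) (h : (c • (1 : Matrix (Fin n) (Fin n) ℂ)).trace = _) :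
    diagBlocks (c • 1) (c • 1) h = 0 := by
  refine (Submodule.Quotient.mk_eq_zero _).2 (mem_center.2 ⟨c, ?_⟩)
  simp [← fromBlocks_one, fromBlocks_smul]

/-- The matrix `A` in the upper left block, completed by a scalar matrix in the lower right one. -/
def leftBlock (hn : n ≠ 0) : Matrix (Fin n) (Fin n) ℂ →ₗ[ℂ] Psl n where
  toFun A := diagBlocks A ((A.trace / n) • 1) (trace_scalar hn A).symm
  map_add' A A' := by
    rw [← diagBlocks_add _ _ (by simp only [trace_add, trace_scalar hn])]
    exact diagBlocks_congr _ _ rfl (by rw [trace_add, add_div, add_smul])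
  map_smul' c A := by
    rw [RingHom.id_apply, ← diagBlocks_smul _ _ (by simp only [trace_smul c, trace_scalar hn])]
    exact diagBlocks_congr _ _ rfl (by rw [trace_smul, smul_eq_mul, mul_div_assoc, mul_smul])

/-- The matrix `D` in the lower right block, completed by a scalar matrix in the upper left one. -/
def rightBlock (hn : n ≠ 0) : Matrix (Fin n) (Fin n) ℂ →ₗ[ℂ] Psl n where
  toFun D := diagBlocks ((D.trace / n) • 1) D (trace_scalar hn D)
  map_add' D D' := by
    rw [← diagBlocks_add _ _ (by simp only [trace_add, trace_scalar hn])]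
    exact diagBlocks_congr _ _ (by rw [trace_add, add_div, add_smul]) rfl
  map_smul' c D := by
    rw [RingHom.id_apply, ← diagBlocks_smul _ _ (by simp only [trace_smul c, trace_scalar hn])]
    exact diagBlocks_congr _ _ (by rw [trace_smul, smul_eq_mul, mul_div_assoc, mul_smul]) rfl

/-- The two completing scalar blocks on the right have the same scalar `tr A / n = tr D / n`, so
together they form a multiple of the identity, which is zero in psl(n|n). -/
lemma diagBlocks_eq (hn : n ≠ 0) (A D : Matrix (Fin n) (Fin n) ℂ) (h : A.trace = D.trace) :
    diagBlocks A D h = leftBlock hn A + rightBlock hn D := by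
  rw [← add_zero (diagBlocks A D h), ← diagBlocks_scalar (n := n) (A.trace / n) rfl,
    ← diagBlocks_add _ _ (by rw [trace_add, trace_add, h])]
  change _ = diagBlocks _ _ (trace_scalar hn A).symm + diagBlocks _ _ (trace_scalar hn D)
  rw [← diagBlocks_add _ _ (by simp only [trace_add, trace_scalar hn, h])]
  exact diagBlocks_congr _ _ (by rw [h]) (add_comm _ _)

lemma leftBlock_one (hn : n ≠ 0) : leftBlock hn 1 = 0 := by
  rw [← diagBlocks_scalar (n := n) 1 rfl]
  exact diagBlocks_congr (trace_scalar hn 1).symm _ (by simp) (by simp [hn])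

lemma rightBlock_one (hn : n ≠ 0) : rightBlock hn 1 = 0 := by
  rw [← diagBlocks_scalar (n := n) 1 rfl]
  exact diagBlocks_congr (trace_scalar hn 1) _ (by simp [hn]) (by simp)

lemma exists_blocks (hn : n ≠ 0) (X : SL n) : cls X = leftBlock hn X.1.toBlocks₁₁ +
    rightBlock hn X.1.toBlocks₂₂ + upperBlock X.1.toBlocks₁₂ + lowerBlock X.1.toBlocks₂₁ := by
  have hX : X.1.toBlocks₁₁.trace = X.1.toBlocks₂₂.trace := sub_eq_zero.1 X.2
  rw [← diagBlocks_eq hn _ _ hX]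
  refine congrArg cls (Subtype.ext ?_)
  change X.1 = fromBlocks X.1.toBlocks₁₁ 0 0 X.1.toBlocks₂₂ + fromBlocks 0 X.1.toBlocks₁₂ 0 0 +
    fromBlocks 0 0 X.1.toBlocks₂₁ 0
  conv_lhs => rw [← fromBlocks_toBlocks X.1]
  simp [fromBlocks_add]

/-! ### Linear algebra: rank one matrices and the minimal orbit. -/

/-- A functional on matrices that vanishes on the rank one nilpotent matrices and on the identity
is zero. -/
lemma eq_zero_of_nilpotent (hn : n ≠ 0) (L : Matrix (Fin n) (Fin n) ℂ →ₗ[ℂ] ℂ) (h1 : L 1 = 0)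
    (h : ∀ v w : Fin n → ℂ, w ⬝ᵥ v = 0 → L (vecMulVec v w) = 0) : L = 0 := by
  have hne (i j : Fin n) (hij : i ≠ j) : L (single i j 1) = 0 := by
    rw [← vecMulVec_single_single]
    exact h _ _ (by simp [hij])
  have hdiag (i j : Fin n) : L (single i i 1) = L (single j j 1) := by
    rcases eq_or_ne i j with rfl | hij
    · rfl
    -- The nilpotent `(e_i + e_j)(e_i - e_j)ᵀ` equals `E_ii - E_jj` plus off-diagonal terms.
    · have := h (Pi.single i 1 + Pi.single j 1) (Pi.single i 1 - Pi.single j 1)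
        (by simp [hij, hij.symm])
      simp only [add_vecMulVec, vecMulVec_sub, vecMulVec_single_single, map_add, map_sub,
        hne i j hij, hne j i hij.symm] at this
      linear_combination this
  have hz (i : Fin n) : L (single i i 1) = 0 := by
    have e : L 1 = n * L (single i i 1) := by
      rw [← diagonal_one, ← sum_single_eq_diagonal, map_sum,
        Finset.sum_congr rfl fun j _ => hdiag j i]
      simp
    rw [h1] at e
    exact (mul_eq_zero.1 e.symm).resolve_left (Nat.cast_ne_zero.2 hn)
  refine (Matrix.stdBasis ℂ (Fin n) (Fin n)).ext fun ⟨i, j⟩ => ?_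
  rw [stdBasis_eq_single, LinearMap.zero_apply]
  rcases eq_or_ne i j with rfl | hij
  · exact hz i
  · exact hne i j hij

lemma eq_zero_of_rank_eq_zero {m : Type} [Fintype m] [DecidableEq m] {M : Matrix m m ℂ}
    (h : M.rank = 0) : M = 0 := by
  rw [Matrix.rank, Submodule.finrank_eq_zero, LinearMap.range_eq_bot] at h
  exact Matrix.ext_of_mulVec_single fun i => by
    rw [zero_mulVec]
    exact LinearMap.congr_fun h (Pi.single i 1)

/-- A matrix with vanishing `2 × 2` minors has rank at most one. -/
lemma rank_le_one {m : Type} [Fintype m] {M : Matrix m m ℂ}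
    (h : ∀ a b c d, M a b * M c d = M c b * M a d) : M.rank ≤ 1 := by
  by_cases h0 : M = 0
  · simp [h0]
  obtain ⟨a, b, hab⟩ : ∃ a b, M a b ≠ 0 := by
    by_contra! hM
    exact h0 (Matrix.ext hM)
  -- With the nonzero entry as pivot, `M` is its column `b` times its row `a` divided by the pivot.
  have : M = vecMulVec (fun i => M i b) (fun j => M a j / M a b) := by
    ext i j
    rw [vecMulVec_apply, mul_div_assoc', eq_div_iff hab]
    linear_combination h a b i j
  rw [this]
  exact rank_vecMulVec_le _ _

/-- The traceless matrices of rank at most one lie in the closure of the minimal orbit. -/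
lemma mem_closure_minOrbit (hn : 2 ≤ n) {Z : LieAlgebra.SpecialLinear.sl (Fin n) ℂ}
    (hZ : Z.1.rank ≤ 1) : Z ∈ closure (minOrbit n) := by
  by_cases h0 : Z = 0
  · subst h0
    have hij : (⟨0, by omega⟩ : Fin n) ≠ ⟨1, by omega⟩ := by simp
    -- Zero has rank 0, so it is reached only as a limit: the multiples `E / (m + 1)` of an
    -- off-diagonal elementary matrix lie in the orbit.
    let E : LieAlgebra.SpecialLinear.sl (Fin n) ℂ :=
      ⟨single ⟨0, by omega⟩ ⟨1, by omega⟩ 1, trace_single_eq_of_ne _ _ _ hij⟩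
    have hE (c : ℂ) (hc : c ≠ 0) : (c • E.1).rank = 1 := by
      refine le_antisymm ?_ (Nat.one_le_iff_ne_zero.2 fun h => ?_)
      · change (c • single _ _ (1 : ℂ)).rank ≤ 1
        rw [← vecMulVec_single_single, ← smul_vecMulVec]
        exact rank_vecMulVec_le _ _
      · have := congrFun₂ (eq_zero_of_rank_eq_zero h) ⟨0, by omega⟩ ⟨1, by omega⟩
        simp [E, hc] at this
    have ht : Filter.Tendsto (fun m : ℕ => (1 / ((m : ℂ) + 1)) • E) Filter.atTop (nhds 0) := by
      rw [tendsto_subtype_rng]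
      have := (tendsto_one_div_add_atTop_nhds_zero_nat (𝕜 := ℂ)).smul_const E.1
      rwa [zero_smul] at this
    refine mem_closure_of_tendsto ht (Filter.Eventually.of_forall fun m => ?_)
    exact hE _ (one_div_ne_zero (Nat.cast_add_one_ne_zero m))
  · refine subset_closure (le_antisymm hZ (Nat.one_le_iff_ne_zero.2 fun h => h0 ?_))
    exact Subtype.ext (eq_zero_of_rank_eq_zero h)

/-! ### The quadratic equations satisfied by a character. -/

section Character

variable {φ : (psl n).Zhu U →ₗ[ℂ] ℂ} {l : Module.Dual ℂ (Psl n)}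

/-- The relation on the functional of a character that comes from the vectors
`y_(-1) z_(-1) |0>` with `y`, `z` of rank one in the upper right block. -/
lemma character_relation (hφ : (psl n).IsCharacter U φ)
    (hl : ∀ x, l x = φ ((psl n).toZhu U ((psl n).mode 1 x (-1) ((psl n).vac 1))))
    (hU : ∀ x m, ∀ v ∈ U, (psl n).mode 1 x m v ∈ U) (hn : n ≠ 0)
    (hmem : ∀ v f f', upperQuad n (vecMulVec v f) (vecMulVec v f') ∈ U)
    (v w w' f f' ξ : Fin n → ℂ) :
    ((f ⬝ᵥ w') * l (leftBlock hn (vecMulVec v ξ)) +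
        (ξ ⬝ᵥ v) * l (rightBlock hn (vecMulVec w' f))) *
      ((f' ⬝ᵥ w) * l (leftBlock hn (vecMulVec v ξ)) +
        (ξ ⬝ᵥ v) * l (rightBlock hn (vecMulVec w f'))) =
    ((f ⬝ᵥ w) * l (leftBlock hn (vecMulVec v ξ)) +
        (ξ ⬝ᵥ v) * l (rightBlock hn (vecMulVec w f))) *
      ((f' ⬝ᵥ w') * l (leftBlock hn (vecMulVec v ξ)) +
        (ξ ⬝ᵥ v) * l (rightBlock hn (vecMulVec w' f'))) := by
  -- The same `ξ` in both lower elements and the same `v` in both upper ones make the upper left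
  -- part of each of the four brackets a multiple of the single matrix `v ξᵀ`.
  have h := hφ.apply_bracket_mul hl hU (lowerBlock_mem (vecMulVec w ξ))
    (lowerBlock_mem (vecMulVec w' ξ)) (upperBlock_mem (vecMulVec v f))
    (upperBlock_mem (vecMulVec v f')) (hmem v f f')
  simpa only [bracket_lowerBlock_upperBlock, diagBlocks_eq hn, vecMulVec_mul_vecMulVec,
    vecMulVec_smul, map_add, map_smul, smul_eq_mul] using h

/-- By `eq_zero_of_nilpotent` only `v ξᵀ` with `ξ·v = 0` matters. There the lower right terms drop
out of `character_relation`, which reads `(f·w')(f'·w) L² = (f·w)(f'·w') L²` with `L = l(v ξᵀ)`. -/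
lemma character_leftBlock (hφ : (psl n).IsCharacter U φ)
    (hl : ∀ x, l x = φ ((psl n).toZhu U ((psl n).mode 1 x (-1) ((psl n).vac 1))))
    (hU : ∀ x m, ∀ v ∈ U, (psl n).mode 1 x m v ∈ U) (hn : 2 ≤ n)
    (hmem : ∀ v f f', upperQuad n (vecMulVec v f) (vecMulVec v f') ∈ U)
    (A : Matrix (Fin n) (Fin n) ℂ) : l (leftBlock (by omega) A) = 0 := by
  have hn' : n ≠ 0 := by omega
  have hcd : (⟨0, by omega⟩ : Fin n) ≠ ⟨1, by omega⟩ := by simp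
  refine LinearMap.congr_fun (eq_zero_of_nilpotent hn' (l ∘ₗ leftBlock hn') ?_ ?_) A
  · rw [LinearMap.comp_apply, leftBlock_one, map_zero]
  · intro v ξ hξ
    -- With `f = w'` and `f' = w` distinct basis vectors the coefficients are 1 on the left and 0 on
    -- the right, leaving `L² = 0`.
    have h := character_relation hφ hl hU hn' hmem v (Pi.single ⟨1, by omega⟩ 1)
      (Pi.single ⟨0, by omega⟩ 1) (Pi.single ⟨0, by omega⟩ 1) (Pi.single ⟨1, by omega⟩ 1) ξ
    simp only [hξ, single_dotProduct, Pi.single_eq_same, Pi.single_eq_of_ne hcd, zero_mul,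
      one_mul, add_zero] at h
    exact mul_self_eq_zero.1 h

/-- Once the upper left block is killed, `v = ξ` a basis vector gives `ξ·v = 1`, and
`character_relation` becomes the vanishing of 2 × 2 minors. -/
lemma character_rightBlock (hφ : (psl n).IsCharacter U φ)
    (hl : ∀ x, l x = φ ((psl n).toZhu U ((psl n).mode 1 x (-1) ((psl n).vac 1))))
    (hU : ∀ x m, ∀ v ∈ U, (psl n).mode 1 x m v ∈ U) (hn : 2 ≤ n)
    (hmem : ∀ v f f', upperQuad n (vecMulVec v f) (vecMulVec v f') ∈ U) (a b c d : Fin n) :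
    l (rightBlock (by omega) (single a b 1)) * l (rightBlock (by omega) (single c d 1)) =
      l (rightBlock (by omega) (single c b 1)) * l (rightBlock (by omega) (single a d 1)) := by
  have hn' : n ≠ 0 := by omega
  have h := character_relation hφ hl hU hn' hmem (Pi.single ⟨0, by omega⟩ 1) (Pi.single c 1)
    (Pi.single a 1) (Pi.single b 1) (Pi.single d 1) (Pi.single ⟨0, by omega⟩ 1)
  simpa only [character_leftBlock hφ hl hU hn hmem, single_dotProduct, Pi.single_eq_same, mul_zero,
    zero_add, one_mul, vecMulVec_single_single] using h

end Character

end PSL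

end

open Matrix in
theorem mainTheorem4 (n : ℕ) (hn : 2 ≤ n) :
    (PSL.psl n).assocVariety ((PSL.psl n).generated 1 (PSL.chi n hn)) ⊆
      PSL.slToDual n '' closure (PSL.minOrbit n) := by
  rintro l ⟨φ, hφ, hl⟩
  have hn' : n ≠ 0 := by omega
  have hU := fun x m v (hv : v ∈ (PSL.psl n).generated 1 (PSL.chi n hn)) =>
    Affine.LieSuperalgebra.mode_mem_generated x m hv
  have hmem := PSL.upperQuad_mem_generated_chi hn
  -- The indices are transposed because `tr(D M)` pairs `D i j` with `M j i`; the factor `2n`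
  -- cancels the normalization of `slToDual`.
  let M : Matrix (Fin n) (Fin n) ℂ :=
    Matrix.of fun i j => (2 * n : ℂ) * l (PSL.rightBlock hn' (single j i 1))
  have hM (D : Matrix (Fin n) (Fin n) ℂ) :
      (1 / (2 * n) : ℂ) * (D * M).trace = l (PSL.rightBlock hn' D) := by
    have hc : (n : ℂ) ≠ 0 := Nat.cast_ne_zero.2 hn'
    have hD : l (PSL.rightBlock hn' D) =
        ∑ i, ∑ j, D i j * l (PSL.rightBlock hn' (single i j 1)) := by
      conv_lhs => rw [matrix_eq_sum_single D]
      simp only [map_sum]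
      refine Finset.sum_congr rfl fun i _ => Finset.sum_congr rfl fun j _ => ?_
      rw [← smul_eq_mul, ← map_smul, ← map_smul, smul_single, smul_eq_mul, mul_one]
    rw [hD, trace, Finset.mul_sum]
    refine Finset.sum_congr rfl fun i _ => ?_
    rw [diag_apply, mul_apply, Finset.mul_sum]
    refine Finset.sum_congr rfl fun j _ => ?_
    simp only [M, of_apply]
    field_simp
  -- The trace of `M` is, up to a factor, the value of `l` at the identity of the lower right block,
  -- which is zero in psl(n|n).
  have htr : M.trace = 0 := by
    have h := hM 1
    rw [PSL.rightBlock_one, map_zero, one_mul] at h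
    exact (mul_eq_zero.1 h).resolve_left (by simp [hn'])
  refine ⟨⟨M, htr⟩, PSL.mem_closure_minOrbit hn (PSL.rank_le_one fun a b c d => ?_), ?_⟩
  · simp only [M, of_apply]
    -- Index pairs are swapped to match the transpose, and `4 n²` comes from two factors `2n`.
    linear_combination (4 * n ^ 2 : ℂ) * PSL.character_rightBlock hφ hl hU hn hmem b a d c
  · refine Submodule.linearMap_qext _ (LinearMap.ext fun X => ?_)
    change (1 / (2 * n) : ℂ) * (X.1.toBlocks₂₂ * M).trace = l (PSL.cls X)
    -- Of the four blocks of `X`, only the lower right one contributes to `l`.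
    rw [PSL.exists_blocks hn' X, map_add, map_add, map_add,
      PSL.character_leftBlock hφ hl hU hn hmem, hφ.apply_odd hl (PSL.upperBlock_mem _),
      hφ.apply_odd hl (PSL.lowerBlock_mem _), hM]
    ring
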